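/- Let $\mathbb F\in\{\mathbb R,\mathbb C\}$, $N\ge 3$, $2\le \hat N\le N$, and let $\mathcal A,\mathcal B\in\mathbb F^{I_1\times\dots\times I_N}$. Notation. For a tensor $\mathcal C\in\mathbb F^{I_1\times\dots\times I_N}$, $\mathbf C_{(n)}$ denotes the matrix whose $I_n$ columns are the vectorized mode-$n$ slices of $\mathcal C$ (obtained by fixing the $n$th index). The product $\mathcal C\bullet_n\mathbf Y$ multiplies every mode-$n$ fiber of $\mathcal C$ by $\mathbf Y$, i.e. $(\mathcal C\bullet_n\mathbf Y)_{(n)}=\mathbf C_{(n)}\mathbf Y^T$. The tensor $\mathcal C$ is ML rank-$(L_1,\dots,L_{\hat N},\cdot,\dots,\cdot)$ if $\operatorname{rank}\mathbf C_{(n)}=L_n$ for $1\le n\le\hat N$. $\operatorname{Bdiag}$ denotes a block-diagonal matrix. Assume that for each $n\in\{1,\dots,\hat N\}$ the matrix $\mathbf A_{(n)}$ has full column rank and $\mathbf B_{(n)}=\mathbf A_{(n)}\mathbf M_n$ for some $\mathbf M_n\in\mathbb F^{I_n\times I_n}$. Then: 1. $\mathbf M_1,\dots,\mathbf M_{\hat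 N}$ have the same minimal polynomial $q$. 2. Let $q=p_1^{\mu_1}\cdots p_R^{\mu_R}$ with distinct monic polynomials $p_r$ irreducible over $\mathbb F$ and $\mu_r\ge1$, and put $L_{nr}=\dim\operatorname{Null}(p_r(\mathbf M_n)^{\mu_r})$. For $n=1,\dots,\hat N$ let $\mathbf M_n=\mathbf S_n\operatorname{Bdiag}(\mathbf T_{n1},\dots,\mathbf T_{nR})\mathbf S_n^{-1}$, $\mathbf S_n=[\mathbf S_{n1}\ \dots\ \mathbf S_{nR}]$, $\mathbf S_{nr}\in\mathbb F^{I_n\times L_{nr}}$, be primary decompositions, where $\mathbf T_{nr}\in\mathbb F^{L_{nr}\times L_{nr}}$ has minimal polynomial $p_r^{\mu_r}$. Then $\mathcal D:=\mathcal A\bullet_1\mathbf S_1^T\cdots\bullet_{\hat N}\mathbf S_{\hat N}^T$ is block diagonal: if the $n$th index range is partitioned into consecutive blocks of lengths $L_{n1},\dots,L_{nR}$ for each $n\le\hat N$, then an entry of $\mathcal D$ is zero unless its first $\hat N$ indices all lie in blocks with the same number $r$. The diagonal blocks $\mathcal D_r\in\mathbb F^{L_{1r}\times\dots\times L_{\hat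 Nr}\times I_{\hat N+1}\times\dots\times I_N}$ satisfy $$\mathcal D_r\bullet_1\mathbf T_{1r}^T=\dots=\mathcal D_r\bullet_{\hat N}\mathbf T_{\hat Nr}^T,\qquad r=1,\dots,R.$$ 3. In the situation of 2, let $\mathbf S_n^{-T}=[\mathbf X^{(n)}_1\ \dots\ \mathbf X^{(n)}_R]$ with $\mathbf X^{(n)}_r\in\mathbb F^{I_n\times L_{nr}}$. Then $$\mathcal A=\sum_{r=1}^R\mathcal A_r,\quad \mathcal A_r:=\mathcal D_r\bullet_1\mathbf X^{(1)}_r\cdots\bullet_{\hat N}\mathbf X^{(\hat N)}_r,\qquad \mathcal B=\sum_{r=1}^R\mathcal B_r,\quad \mathcal B_r:=(\mathcal D_r\bullet_1\mathbf T_{1r}^T)\bullet_1\mathbf X^{(1)}_r\cdots\bullet_{\hat N}\mathbf X^{(\hat N)}_r .$$ Every $\mathcal A_r$ is ML rank-$(L_{1r},\dots,L_{\hat Nr},\cdot,\dots,\cdot)$. The mode-$n$ rank of $\mathcal B_r$ is at most $L_{nr}$ for all $n\le\hat N$, and $\mathcal B_r$ is ML rank-$(L_{1r},\dots,L_{\hat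 Nr},\cdot,\dots,\cdot)$ whenever $p_r(x)\ne x$ (hence for all $r$ if the $\mathbf M_n$ are nonsingular). 4. Let $i\ne j$, $i,j\le\hat N$. If $I_i=I_j$ and some linear combination of the $I_i\times I_j$ slices of $\mathcal A$ (obtained by fixing all indices but the $i$th and the $j$th) is nonsingular, then $\mathbf M_i$ is similar to $\mathbf M_j$. 5. If $i,j\le\hat N$ and $\mathbf M_i$ is similar to $\mathbf M_j$, then $L_{ir}=L_{jr}$ for all $r$, and the primary decompositions in 2 can be chosen such that $\mathbf T_{ir}=\mathbf T_{jr}$ for all $r$. 6. In the situation of 3, if $\mathbf T_{nr}=\lambda\mathbf I_{L_{nr}}$ for some $r$, some $n\le\hat N$ and some $\lambda\in\mathbb F$, then $\mathcal B_r=\lambda\mathcal A_r$. 7. In the situation of 3, if for each $r$ there is an $n_r\le\hat N$ with $\mathbf T_{n_rr}=\lambda_r\mathbf I_{L_{n_rr}}$, then $\mathcal B=\sum_{r=1}^R\lambda_r\mathcal A_r$, i.e. $\mathcal B$ consists of the (scaled) ML rank-$(L_{1r},\dots,L_{\hat Nr},\cdot,\dots,\cdot)$ terms $\mathcal A_r$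 of $\mathcal A$; here $\lambda_r=0$ if and only if $p_r(x)=x$. -/

import Mathlib

namespace TensorSim

/-- An `N`-th order tensor of size `I 0 × ⋯ × I (N-1)` over `𝕜`. -/
abbrev Tensor (𝕜 : Type*) {N : ℕ} (I : Fin N → ℕ) : Type _ :=
  (∀ n : Fin N, Fin (I n)) → 𝕜

/-- The modes `1, …, Nh` of an order `N` tensor (as `0, …, Nh - 1`). -/
abbrev FirstMode (N Nh : ℕ) : Type := {n : Fin N // n.val < Nh}

/-- The modes `Nh + 1, …, N` of an order `N` tensor. -/
abbrev RestMode (N Nh : ℕ) : Type := {n : Fin N // ¬ n.val < Nh}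

/-- The mode-`n` matrix representation `A_(n)`: the entry in the column `i` and in the row given by
the values `ρ` of all the other indices is the corresponding entry of `A`. Rows are labelled by
multi-indices instead of by their position in a fixed enumeration of the multi-indices. -/
def unfolding {𝕜 : Type*} {N : ℕ} {I : Fin N → ℕ} (A : Tensor 𝕜 I) (n : Fin N) :
    Matrix (∀ m : {m : Fin N // m ≠ n}, Fin (I m)) (Fin (I n)) 𝕜 :=
  Matrix.of fun ρ i => A ((Equiv.piSplitAt n (fun m => Fin (I m))).symm (i, ρ))

/-- `A` is ML rank-`(L_1, …, L_Nh, ·, …, ·)`. -/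
def IsMLRank {𝕜 : Type*} [RCLike 𝕜] {N Nh : ℕ} {I : Fin N → ℕ} (A : Tensor 𝕜 I)
    (L : FirstMode N Nh → ℕ) : Prop :=
  ∀ n : FirstMode N Nh, (unfolding A n.1).rank = L n

/-- The `I_i × I_j` slice of `A` obtained by fixing all indices but those in the modes `i ≠ j`
to the values given by `b`; the entries of `b` in the modes `i` and `j` play no role. -/
def slice {𝕜 : Type*} {N : ℕ} {I : Fin N → ℕ} (A : Tensor 𝕜 I) (i j : Fin N)
    (b : ∀ n : Fin N, Fin (I n)) : Matrix (Fin (I i)) (Fin (I j)) 𝕜 :=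
  Matrix.of fun x y => A (Function.update (Function.update b i x) j y)

/-- A tensor whose index in each of the first `Nh` modes `n` runs over `κ n` and whose index in
each of the remaining modes `n` runs over `Fin (I n)`; the two groups of indices are separate
arguments. -/
abbrev SplitTensor (𝕜 : Type*) {N : ℕ} (Nh : ℕ) (I : Fin N → ℕ) (κ : FirstMode N Nh → Type) :
    Type _ :=
  (∀ n, κ n) → (∀ n : RestMode N Nh, Fin (I n.1)) → 𝕜

/-- A tensor, with the indices of the first `Nh` modes separated from the other ones. -/
def toSplit {𝕜 : Type*} {N : ℕ} (Nh : ℕ) {I : Fin N → ℕ} (A : Tensor 𝕜 I) :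
    SplitTensor 𝕜 Nh I (fun n => Fin (I n.1)) :=
  fun i t => A ((Equiv.piEquivPiSubtypeProd (fun n : Fin N => n.val < Nh)
    (fun n => Fin (I n))).symm (i, t))

/-- The inverse of `toSplit`. -/
def ofSplit {𝕜 : Type*} {N Nh : ℕ} {I : Fin N → ℕ}
    (D : SplitTensor 𝕜 Nh I (fun n => Fin (I n.1))) : Tensor 𝕜 I :=
  fun i => D (fun n => i n.1) (fun n => i n.1)

/-- The product `D •_1 Y_1 ⋯ •_Nh Y_Nh` in the first `Nh` modes. -/
def multiProd {𝕜 : Type*} [RCLike 𝕜] {N Nh : ℕ} {I : Fin N → ℕ}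
    {κ κ' : FirstMode N Nh → Type} [∀ n, Fintype (κ n)]
    (Y : ∀ n, Matrix (κ' n) (κ n) 𝕜) (D : SplitTensor 𝕜 Nh I κ) : SplitTensor 𝕜 Nh I κ' :=
  fun i t => ∑ k : (∀ n, κ n), (∏ n, Y n (i n) (k n)) * D k t

/-- The mode-`n` product `D •_n Y` with a square matrix: all mode-`n` fibers of `D` are multiplied
by `Y`. -/
def modeProd {𝕜 : Type*} [RCLike 𝕜] {N Nh : ℕ} {I : Fin N → ℕ}
    {κ : FirstMode N Nh → Type} [∀ n, Fintype (κ n)] (n : FirstMode N Nh)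
    (Y : Matrix (κ n) (κ n) 𝕜) (D : SplitTensor 𝕜 Nh I κ) : SplitTensor 𝕜 Nh I κ :=
  fun i t => ∑ l : κ n, Y (i n) l * D (Function.update i n l) t

/-- `D` is block diagonal: the index of mode `n ≤ Nh` runs over `R` consecutive blocks, the `r`-th
one of length `L n r`, and an entry of `D` vanishes unless the indices of the first `Nh` modes all
lie in blocks with the same number `r`. -/
def IsBlockDiagonal {𝕜 : Type*} [RCLike 𝕜] {N Nh R : ℕ} {I : Fin N → ℕ}
    {L : FirstMode N Nh → Fin R → ℕ}
    (D : SplitTensor 𝕜 Nh I (fun n => Σ r : Fin R, Fin (L n r))) : Prop :=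
  ∀ k t, (¬ ∃ r : Fin R, ∀ n, (k n).1 = r) → D k t = 0

/-- The `r`-th diagonal block `D_r`. -/
def diagBlock {𝕜 : Type*} {N Nh R : ℕ} {I : Fin N → ℕ} {L : FirstMode N Nh → Fin R → ℕ}
    (D : SplitTensor 𝕜 Nh I (fun n => Σ r : Fin R, Fin (L n r))) (r : Fin R) :
    SplitTensor 𝕜 Nh I (fun n => Fin (L n r)) :=
  fun k t => D (fun n => ⟨r, k n⟩) t

/-- The concatenation `[S_1 ⋯ S_R]`. -/
def concatCols {𝕜 : Type*} {a R : ℕ} {L : Fin R → ℕ} (S : ∀ r, Matrix (Fin a) (Fin (L r)) 𝕜) :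
    Matrix (Fin a) (Σ r : Fin R, Fin (L r)) 𝕜 :=
  Matrix.of fun i k => S k.1 i k.2

/-- `Q` is the (two-sided) inverse of `P`, where the rows and the columns of `P` may be labelled by
different index types. -/
def AreInverse {𝕜 : Type*} [RCLike 𝕜] {α β : Type} [Fintype α] [Fintype β] [DecidableEq α]
    [DecidableEq β] (P : Matrix α β 𝕜) (Q : Matrix β α 𝕜) : Prop :=
  P * Q = 1 ∧ Q * P = 1

/-- Similarity of square matrices (it forces the sizes to be equal). -/
def MatSimilar {𝕜 : Type*} [RCLike 𝕜] {a b : ℕ} (M : Matrix (Fin a) (Fin a) 𝕜)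
    (M' : Matrix (Fin b) (Fin b) 𝕜) : Prop :=
  ∃ (P : Matrix (Fin a) (Fin b) 𝕜) (Q : Matrix (Fin b) (Fin a) 𝕜),
    AreInverse P Q ∧ M = P * M' * Q

/-- `q = p_1 ^ μ_1 ⋯ p_R ^ μ_R` with distinct monic irreducible `p_r` and `μ_r ≥ 1`. -/
def IsPrimaryFactorization {𝕜 : Type*} [RCLike 𝕜] {R : ℕ} (q : Polynomial 𝕜)
    (p : Fin R → Polynomial 𝕜) (μ : Fin R → ℕ) : Prop :=
  (∀ r, (p r).Monic) ∧ (∀ r, Irreducible (p r)) ∧ Function.Injective p ∧ (∀ r, 1 ≤ μ r) ∧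
    q = ∏ r, p r ^ μ r

/-- The dimension of the null space of `P(M)`. -/
noncomputable def nullDim {𝕜 : Type*} [RCLike 𝕜] {a : ℕ} (M : Matrix (Fin a) (Fin a) 𝕜)
    (P : Polynomial 𝕜) : ℕ :=
  Module.finrank 𝕜 (LinearMap.ker (Matrix.mulVecLin (Polynomial.aeval M P)))

/-- `M = S Bdiag(T_1, …, T_R) S⁻¹` with `S = [S_1 ⋯ S_R]` nonsingular and with `p_r ^ μ_r` the
minimal polynomial of `T_r`. Since `p_r ^ μ_r` annihilates `T_r`, the columns of `S_r` lie in the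
null space of `p_r(M) ^ μ_r`; if the `p_r` are distinct irreducible monic polynomials they
form a basis of it. -/
def IsPrimaryDecomposition {𝕜 : Type*} [RCLike 𝕜] {a R : ℕ} (M : Matrix (Fin a) (Fin a) 𝕜)
    (p : Fin R → Polynomial 𝕜) (μ : Fin R → ℕ) {L : Fin R → ℕ}
    (S : ∀ r, Matrix (Fin a) (Fin (L r)) 𝕜) (T : ∀ r, Matrix (Fin (L r)) (Fin (L r)) 𝕜) : Prop :=
  (∃ W : Matrix (Σ r : Fin R, Fin (L r)) (Fin a) 𝕜,
    AreInverse (concatCols S) W ∧ M = concatCols S * Matrix.blockDiagonal' T * W) ∧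
  ∀ r, minpoly 𝕜 (T r) = p r ^ μ r

/-- The tensor `D = A •_1 S_1ᵀ ⋯ •_Nh S_Nhᵀ`, where `S_n = [S_n1 ⋯ S_nR]`. -/
def coreTensor {𝕜 : Type*} [RCLike 𝕜] {N Nh R : ℕ} {I : Fin N → ℕ}
    {L : FirstMode N Nh → Fin R → ℕ} (A : Tensor 𝕜 I)
    (S : ∀ (n : FirstMode N Nh) (r : Fin R), Matrix (Fin (I n.1)) (Fin (L n r)) 𝕜) :
    SplitTensor 𝕜 Nh I (fun n => Σ r : Fin R, Fin (L n r)) :=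
  multiProd (fun n => (concatCols (S n)).transpose) (toSplit Nh A)

/-- The term `D_r •_1 X_r^(1) ⋯ •_Nh X_r^(Nh)`. -/
def mlTerm {𝕜 : Type*} [RCLike 𝕜] {N Nh : ℕ} {I : Fin N → ℕ} {l : FirstMode N Nh → ℕ}
    (X : ∀ n : FirstMode N Nh, Matrix (Fin (I n.1)) (Fin (l n)) 𝕜)
    (D : SplitTensor 𝕜 Nh I (fun n => Fin (l n))) : Tensor 𝕜 I :=
  ofSplit (multiProd X D)

/-- The mode `1`. -/
def modeOne {N Nh : ℕ} (hNh : 2 ≤ Nh) (hle : Nh ≤ N) : FirstMode N Nh :=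
  ⟨⟨0, by omega⟩, by simp; omega⟩

/-- `A_r = D_r •_1 X_r^(1) ⋯ •_Nh X_r^(Nh)`, where `D_r` is the `r`-th diagonal block of
`D = A •_1 S_1ᵀ ⋯ •_Nh S_Nhᵀ`. -/
def termA {𝕜 : Type*} [RCLike 𝕜] {N Nh R : ℕ} {I : Fin N → ℕ} {L : FirstMode N Nh → Fin R → ℕ}
    (A : Tensor 𝕜 I)
    (S X : ∀ (n : FirstMode N Nh) (r : Fin R), Matrix (Fin (I n.1)) (Fin (L n r)) 𝕜)
    (r : Fin R) : Tensor 𝕜 I :=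
  mlTerm (fun n => X n r) (diagBlock (coreTensor A S) r)

/-- `B_r = (D_r •_1 T_1rᵀ) •_1 X_r^(1) ⋯ •_Nh X_r^(Nh)`; the mode in which the product with the
matrix `T_nrᵀ` is taken is the argument `n₁`. -/
def termB {𝕜 : Type*} [RCLike 𝕜] {N Nh R : ℕ} {I : Fin N → ℕ} {L : FirstMode N Nh → Fin R → ℕ}
    (n₁ : FirstMode N Nh) (A : Tensor 𝕜 I)
    (S : ∀ (n : FirstMode N Nh) (r : Fin R), Matrix (Fin (I n.1)) (Fin (L n r)) 𝕜)
    (T : ∀ (n : FirstMode N Nh) (r : Fin R), Matrix (Fin (L n r)) (Fin (L n r)) 𝕜)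
    (X : ∀ (n : FirstMode N Nh) (r : Fin R), Matrix (Fin (I n.1)) (Fin (L n r)) 𝕜)
    (r : Fin R) : Tensor 𝕜 I :=
  mlTerm (fun n => X n r)
    (modeProd n₁ (T n₁ r).transpose (diagBlock (coreTensor A S) r))

end TensorSim

open TensorSim

/-! Everything rests on one identity. If `C` is a slice of `A` in two modes `i ≠ j` among the first
`Nh`, then `(M i)ᵀ * C = C * M j`, because both sides are the same slice of `B`
(`transpose_mul_slice_eq`). Hence `(f (M i))ᵀ * C = C * f (M j)` for every polynomial `f`.

With `f` the minimal polynomial of `M i`, every slice is killed by `f (M j)`. The rows of these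
slices are the rows of the mode-`j` unfolding, so full column rank gives `f (M j) = 0`, and the
minimal polynomials divide each other.

After the change of basis to primary components, the slice blocks of the core tensor intertwine the
`T n r`. Blocks with different numbers have coprime annihilators and vanish by Bézout
(`eq_zero_of_isCoprime_annihilators`). Undoing the change of basis writes `A` and `B` as sums over
the diagonal blocks. The ranks of the terms of `A` are at most `L n r`, and these bounds add up to
the full rank `I n`, so all are attained.

A nonsingular combination of slices makes `(M i)ᵀ` similar to `M j`. It remains to know that a
matrix is similar to its transpose (`exists_det_ne_zero_transpose_mul_eq`), which follows from a
nondegenerate bilinear form for which the matrix is self-adjoint. -/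

namespace TensorSim

open Polynomial Matrix

/-! ### Intertwining relations; similarity of a matrix to its transpose. -/

section Field

variable {𝕜 : Type*} [Field 𝕜] {m n : Type*} [Fintype m] [Fintype n] [DecidableEq m] [DecidableEq n]

theorem aeval_mul_eq_mul_aeval {W : Matrix m m 𝕜} {V : Matrix n n 𝕜} {C : Matrix m n 𝕜}
    (h : W * C = C * V) (f : 𝕜[X]) : aeval W f * C = C * aeval V f := by
  induction f using Polynomial.induction_on' with
  | add p q hp hq => simp [Matrix.add_mul, Matrix.mul_add, hp, hq]
  | monomial k c =>
    have hk : ∀ k : ℕ, W ^ k * C = C * V ^ k := by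
      intro k
      induction k with
      | zero => simp
      | succ k ih => rw [pow_succ, pow_succ, Matrix.mul_assoc, h, ← Matrix.mul_assoc, ih,
          Matrix.mul_assoc]
    simp [aeval_monomial, Algebra.algebraMap_eq_smul_one, hk]

/-- Write `a * f + b * g = 1`: the first summand dies at `W`, the second dies once it is moved
through `C` to `V`. -/
theorem eq_zero_of_isCoprime_annihilators {W : Matrix m m 𝕜} {V : Matrix n n 𝕜}
    {C : Matrix m n 𝕜} (h : W * C = C * V) {f g : 𝕜[X]} (hfg : IsCoprime f g)
    (hf : aeval W f = 0) (hg : aeval V g = 0) : C = 0 := by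
  obtain ⟨a, b, hab⟩ := hfg
  have h1 : aeval W (a * f + b * g) * C = 0 := by
    rw [map_add, Matrix.add_mul, aeval_mul_eq_mul_aeval h (b * g), map_mul, map_mul, hf, hg]
    simp
  simpa [hab] using h1

theorem aeval_transpose (M : Matrix n n 𝕜) (f : 𝕜[X]) : aeval Mᵀ f = (aeval M f)ᵀ := by
  induction f using Polynomial.induction_on' with
  | add p q hp hq => simp [hp, hq]
  | monomial k c => simp [aeval_monomial, Algebra.algebraMap_eq_smul_one]

/-- The algebra `𝕜[X] / (p ^ e)`, with `p` irreducible, is a Frobenius algebra. -/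
theorem exists_nondegenerate_functional {p : 𝕜[X]} (hp : Irreducible p) (e : ℕ) :
    ∃ φ : (𝕜[X] ⧸ Ideal.span {p ^ e}) →ₗ[𝕜] 𝕜, ∀ u, (∀ v, φ (u * v) = 0) → u = 0 := by
  cases e with
  | zero =>
    refine ⟨0, fun u _ => ?_⟩
    obtain ⟨a, rfl⟩ := Ideal.Quotient.mk_surjective u
    rw [Ideal.Quotient.eq_zero_iff_mem, Ideal.mem_span_singleton]
    simp
  | succ k =>
    -- The class of `p ^ k` generates the unique minimal ideal. A functional that is nonzero on this
    -- class suffices, since every nonzero `u` has it as a multiple.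
    have hs : Ideal.Quotient.mk (Ideal.span {p ^ (k + 1)}) (p ^ k) ≠ 0 := by
      rw [Ne, Ideal.Quotient.eq_zero_iff_mem, Ideal.mem_span_singleton]
      intro h
      exact absurd ((pow_dvd_pow_iff hp.ne_zero hp.not_isUnit).1 h) (by omega)
    obtain ⟨φ, hφ⟩ : ∃ φ : Module.Dual 𝕜 (𝕜[X] ⧸ Ideal.span {p ^ (k + 1)}),
        φ (Ideal.Quotient.mk (Ideal.span {p ^ (k + 1)}) (p ^ k)) ≠ 0 := by
      by_contra! h
      exact hs ((Module.forall_dual_apply_eq_zero_iff 𝕜 _).1 h)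
    refine ⟨φ, fun u hu => ?_⟩
    by_contra hu0
    obtain ⟨a, rfl⟩ := Ideal.Quotient.mk_surjective u
    have ha : a ≠ 0 := by rintro rfl; simp at hu0
    obtain ⟨j, w, hw, rfl⟩ := WfDvdMonoid.max_power_factor ha hp
    have hj : j ≤ k := by
      by_contra! hj
      exact hu0 (by
        rw [Ideal.Quotient.eq_zero_iff_mem, Ideal.mem_span_singleton]
        exact Dvd.dvd.mul_right (pow_dvd_pow p hj) w)
    -- `c` inverts `w` modulo `p ^ (k + 1)`, so `c * p ^ (k - j)` multiplies `p ^ j * w` to `p ^ k`.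
    obtain ⟨c, d, hcd⟩ : IsCoprime w (p ^ (k + 1)) :=
      ((hp.coprime_iff_not_dvd.2 hw).symm).pow_right
    apply hφ
    rw [← hu (Ideal.Quotient.mk _ (c * p ^ (k - j))), ← map_mul]
    congr 1
    rw [Ideal.Quotient.eq, Ideal.mem_span_singleton]
    refine ⟨p ^ k * d, ?_⟩
    have hpk : p ^ j * p ^ (k - j) = p ^ k := by rw [← pow_add]; congr 1; omega
    calc p ^ k - p ^ j * w * (c * p ^ (k - j))
        = p ^ k * 1 - (p ^ j * p ^ (k - j)) * (w * c) := by ring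
      _ = p ^ (k + 1) * (p ^ k * d) := by rw [hpk, ← hcd]; ring

/-- An endomorphism is self-adjoint with respect to some nondegenerate bilinear form. -/
theorem exists_nondegenerate_selfAdjoint {V : Type*} [AddCommGroup V] [Module 𝕜 V]
    [FiniteDimensional 𝕜 V] (φ : Module.End 𝕜 V) :
    ∃ b : V →ₗ[𝕜] V →ₗ[𝕜] 𝕜, (∀ x, (∀ y, b x y = 0) → x = 0) ∧
      ∀ x y, b (φ x) y = b x (φ y) := by
  classical
  obtain ⟨ι, _, p, hp, e, ⟨E⟩⟩ := Module.equiv_directSum_of_isTorsion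
    (Module.AEval.isTorsion_of_finiteDimensional 𝕜 V φ)
  choose ψ hψ using fun i => exists_nondegenerate_functional (hp i) (e i)
  -- The coordinates of `V` as a sum of cyclic `𝕜[X]`-modules; in them `φ` is multiplication by `X`.
  let c : ∀ i, V →ₗ[𝕜] (𝕜[X] ⧸ Ideal.span {p i ^ e i}) := fun i =>
    { toFun := fun x => E (Module.AEval.of 𝕜 V φ x) i
      map_add' := fun x y => by simp
      map_smul' := fun a x => by
        simp only [map_smul, RingHom.id_apply]
        rw [← Module.AEval.C_smul, map_smul, DirectSum.smul_apply]
        change C a • (show 𝕜[X] ⧸ Ideal.span {p i ^ e i} from E (Module.AEval.of 𝕜 V φ x) i) = _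
        rw [← algebraMap_smul 𝕜[X] a]
        rfl }
  have hcφ : ∀ i x, c i (φ x) = (X : 𝕜[X]) • c i x := by
    intro i x
    change E (Module.AEval.of 𝕜 V φ (φ • x)) i = _
    rw [← Module.AEval.X_smul_of, map_smul, DirectSum.smul_apply]
    rfl
  have hc : ∀ x, (∀ i, c i x = 0) → x = 0 := by
    intro x hx
    have : E (Module.AEval.of 𝕜 V φ x) = 0 := by
      ext i
      exact hx i
    simpa using this
  have hcs : ∀ i u, ∃ x, c i x = u ∧ ∀ j, j ≠ i → c j x = 0 := by
    intro i u
    refine ⟨(Module.AEval.of 𝕜 V φ).symm (E.symm (DirectSum.of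
      (fun i => 𝕜[X] ⧸ Submodule.span 𝕜[X] {p i ^ e i}) i u)), ?_, fun j hj => ?_⟩
    · change E (Module.AEval.of 𝕜 V φ _) i = _
      simp
    · change E (Module.AEval.of 𝕜 V φ _) j = _
      simp
      exact DirectSum.of_eq_of_ne i j _ hj
  -- The form is `b x y = ∑ i, ψ i (c i x * c i y)`. Self-adjointness holds because `X` moves freely
  -- across a product in a commutative algebra.
  refine ⟨∑ i, ((LinearMap.mul 𝕜 (𝕜[X] ⧸ Ideal.span {p i ^ e i})).compr₂ (ψ i)).compl₁₂ (c i) (c i),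
    fun x hx => hc x fun i => hψ i _ fun v => ?_, fun x y => ?_⟩
  · obtain ⟨y, hy, hy'⟩ := hcs i v
    have := hx y
    simp only [LinearMap.sum_apply, LinearMap.compl₁₂_apply, LinearMap.compr₂_apply,
      LinearMap.mul_apply'] at this
    rwa [Finset.sum_eq_single i (fun j _ hj => by rw [hy' j hj]; simp) (by simp), hy] at this
  · simp only [LinearMap.sum_apply, LinearMap.compl₁₂_apply, LinearMap.compr₂_apply,
      LinearMap.mul_apply', hcφ, smul_mul_assoc, mul_smul_comm]

/-- Every square matrix is similar to its transpose. -/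
theorem exists_det_ne_zero_transpose_mul_eq (M : Matrix n n 𝕜) :
    ∃ G : Matrix n n 𝕜, G.det ≠ 0 ∧ Mᵀ * G = G * M := by
  obtain ⟨b, hb, hbM⟩ := exists_nondegenerate_selfAdjoint (Matrix.toLin' M)
  have hb' : LinearMap.toMatrix₂' 𝕜 b * M = Mᵀ * LinearMap.toMatrix₂' 𝕜 b := by
    have h1 := LinearMap.toMatrix₂'_compl₁₂ (R := 𝕜) b LinearMap.id (Matrix.toLin' M)
    have h2 := LinearMap.toMatrix₂'_compl₁₂ (R := 𝕜) b (Matrix.toLin' M) LinearMap.id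
    have h3 : b.compl₁₂ LinearMap.id (Matrix.toLin' M) =
        b.compl₁₂ (Matrix.toLin' M) LinearMap.id :=
      LinearMap.ext₂ fun x y => (hbM x y).symm
    rw [h3, h2] at h1
    simpa using h1.symm
  refine ⟨LinearMap.toMatrix₂' 𝕜 b, fun hdet => ?_, hb'.symm⟩
  obtain ⟨v, hv, hv'⟩ := Matrix.exists_vecMul_eq_zero_iff.2 hdet
  refine hv (hb v fun y => ?_)
  have : b v y = v ⬝ᵥ LinearMap.toMatrix₂' 𝕜 b *ᵥ y := by
    conv_lhs => rw [← Matrix.toLinearMap₂'_toMatrix' (R := 𝕜) b]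
    rw [Matrix.toLinearMap₂'_apply']
  rw [this, Matrix.dotProduct_mulVec, hv', zero_dotProduct]

end Field

end TensorSim

namespace TensorSim

open Polynomial Matrix

/-! ### Similarity and primary decompositions of matrices. -/

section PrimaryDecomposition

variable {𝕜 : Type*} [RCLike 𝕜]

theorem AreInverse.card_eq {α β : Type} [Fintype α] [Fintype β] [DecidableEq α] [DecidableEq β]
    {P : Matrix α β 𝕜} {Q : Matrix β α 𝕜} (h : AreInverse P Q) :
    Fintype.card α = Fintype.card β :=
  Matrix.square_of_invertible P Q h.1 h.2

theorem matSimilar_of_mul_eq_mul {a b : ℕ} {M : Matrix (Fin a) (Fin a) 𝕜}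
    {M' : Matrix (Fin b) (Fin b) 𝕜} (h : a = b) (C : Matrix (Fin a) (Fin b) 𝕜)
    (hC : (C.submatrix id (Fin.cast h)).det ≠ 0) (hMC : M * C = C * M') : MatSimilar M M' := by
  subst h
  have hC' : IsUnit C.det := isUnit_iff_ne_zero.2 hC
  exact ⟨C, C⁻¹, ⟨Matrix.mul_nonsing_inv C hC', Matrix.nonsing_inv_mul C hC'⟩, by
    rw [← hMC, Matrix.mul_assoc, Matrix.mul_nonsing_inv C hC', Matrix.mul_one]⟩

theorem MatSimilar.symm {a b : ℕ} {M : Matrix (Fin a) (Fin a) 𝕜}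
    {M' : Matrix (Fin b) (Fin b) 𝕜} (h : MatSimilar M M') : MatSimilar M' M := by
  obtain ⟨P, Q, hPQ, rfl⟩ := h
  refine ⟨Q, P, ⟨hPQ.2, hPQ.1⟩, ?_⟩
  rw [Matrix.mul_assoc P, ← Matrix.mul_assoc, hPQ.2, Matrix.one_mul, Matrix.mul_assoc, hPQ.2,
    Matrix.mul_one]

theorem nullDim_add_rank {a : ℕ} (M : Matrix (Fin a) (Fin a) 𝕜) (f : 𝕜[X]) :
    nullDim M f + (aeval M f).rank = a := by
  have := LinearMap.finrank_range_add_finrank_ker (Matrix.mulVecLin (aeval M f))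
  rw [Module.finrank_fin_fun] at this
  rw [nullDim, Matrix.rank, add_comm, this]

theorem MatSimilar.rank_aeval_le {a b : ℕ} {M : Matrix (Fin a) (Fin a) 𝕜}
    {M' : Matrix (Fin b) (Fin b) 𝕜} (h : MatSimilar M M') (f : 𝕜[X]) :
    (aeval M f).rank ≤ (aeval M' f).rank := by
  obtain ⟨P, Q, hPQ, hM⟩ := h
  have h1 : M * P = P * M' := by
    rw [hM, Matrix.mul_assoc, hPQ.2, Matrix.mul_one]
  have h2 : aeval M f = P * aeval M' f * Q := by
    rw [← aeval_mul_eq_mul_aeval h1, Matrix.mul_assoc, hPQ.1, Matrix.mul_one]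
  rw [h2]
  exact (Matrix.rank_mul_le_left _ _).trans (Matrix.rank_mul_le_right _ _)

theorem MatSimilar.nullDim_eq {a b : ℕ} {M : Matrix (Fin a) (Fin a) 𝕜}
    {M' : Matrix (Fin b) (Fin b) 𝕜} (h : MatSimilar M M') (f : 𝕜[X]) :
    nullDim M f = nullDim M' f := by
  have hab : a = b := by
    obtain ⟨P, Q, hPQ, -⟩ := h
    simpa using hPQ.card_eq
  have h1 := nullDim_add_rank M f
  have h2 := nullDim_add_rank M' f
  have h3 := h.rank_aeval_le f
  have h4 := h.symm.rank_aeval_le f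
  omega

theorem mul_concatCols {a b R : ℕ} {L : Fin R → ℕ} (P : Matrix (Fin b) (Fin a) 𝕜)
    (S : ∀ r, Matrix (Fin a) (Fin (L r)) 𝕜) :
    P * concatCols S = concatCols fun r => P * S r := by
  ext i k
  simp [concatCols, Matrix.mul_apply]

theorem concatCols_mul_blockDiagonal' {a R : ℕ} {L : Fin R → ℕ}
    (S : ∀ r, Matrix (Fin a) (Fin (L r)) 𝕜) (T : ∀ r, Matrix (Fin (L r)) (Fin (L r)) 𝕜) :
    concatCols S * Matrix.blockDiagonal' T = concatCols fun r => S r * T r := by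
  ext i ⟨r, k⟩
  simp only [concatCols, Matrix.mul_apply, Matrix.of_apply, Fintype.sum_sigma]
  rw [Finset.sum_eq_single r]
  · simp [Matrix.blockDiagonal'_apply_eq]
  · intro s _ hs
    exact Finset.sum_eq_zero fun l _ => by rw [Matrix.blockDiagonal'_apply_ne _ _ _ hs, mul_zero]
  · simp

theorem concatCols_mul_transpose {a b R : ℕ} {L : Fin R → ℕ}
    (S : ∀ r, Matrix (Fin a) (Fin (L r)) 𝕜) (X : ∀ r, Matrix (Fin b) (Fin (L r)) 𝕜) :
    concatCols S * (concatCols X)ᵀ = ∑ r, S r * (X r)ᵀ := by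
  ext i k
  simp [concatCols, Matrix.mul_apply, Fintype.sum_sigma, Matrix.sum_apply]

theorem concatCols_injective {𝕜 : Type*} {a R : ℕ} {L : Fin R → ℕ}
    {S S' : ∀ r, Matrix (Fin a) (Fin (L r)) 𝕜} (h : concatCols S = concatCols S') (r : Fin R) :
    S r = S' r := by
  ext i k
  exact congrFun (congrFun h i) ⟨r, k⟩

theorem transpose_concatCols_mul_apply {a R : ℕ} {L : Fin R → ℕ}
    (X S : ∀ r, Matrix (Fin a) (Fin (L r)) 𝕜) (r s : Fin R) (k : Fin (L r)) (l : Fin (L s)) :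
    ((concatCols X)ᵀ * concatCols S) ⟨r, k⟩ ⟨s, l⟩ = ((X r)ᵀ * S s) k l := by
  simp [concatCols, Matrix.mul_apply]

theorem IsPrimaryDecomposition.mul_eq {a R : ℕ} {M : Matrix (Fin a) (Fin a) 𝕜}
    {p : Fin R → 𝕜[X]} {μ : Fin R → ℕ} {L : Fin R → ℕ}
    {S : ∀ r, Matrix (Fin a) (Fin (L r)) 𝕜} {T : ∀ r, Matrix (Fin (L r)) (Fin (L r)) 𝕜}
    (h : IsPrimaryDecomposition M p μ S T) (r : Fin R) : M * S r = S r * T r := by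
  obtain ⟨⟨W, hW, hM⟩, -⟩ := h
  refine concatCols_injective (S := fun r => M * S r) (S' := fun r => S r * T r) ?_ r
  rw [← mul_concatCols, ← concatCols_mul_blockDiagonal', hM, Matrix.mul_assoc, hW.2,
    Matrix.mul_one]

/-- Primary decompositions are transported by similarities. -/
theorem IsPrimaryDecomposition.of_matSimilar {a b R : ℕ} {M : Matrix (Fin a) (Fin a) 𝕜}
    {M' : Matrix (Fin b) (Fin b) 𝕜} (hM : MatSimilar M M') {p : Fin R → 𝕜[X]} {μ : Fin R → ℕ}
    {l l' : Fin R → ℕ} (h : ∀ r, l r = l' r) {S' : ∀ r, Matrix (Fin b) (Fin (l' r)) 𝕜}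
    {T' : ∀ r, Matrix (Fin (l' r)) (Fin (l' r)) 𝕜} (hT : IsPrimaryDecomposition M' p μ S' T') :
    ∃ (S : ∀ r, Matrix (Fin a) (Fin (l r)) 𝕜) (T : ∀ r, Matrix (Fin (l r)) (Fin (l r)) 𝕜),
      IsPrimaryDecomposition M p μ S T ∧
        ∀ r, T r = (T' r).submatrix (Fin.cast (h r)) (Fin.cast (h r)) := by
  obtain rfl : l = l' := funext h
  obtain ⟨P, Q, hPQ, rfl⟩ := hM
  obtain ⟨⟨W, hW, rfl⟩, hmin⟩ := hT
  refine ⟨fun r => P * S' r, T', ⟨⟨W * Q, ⟨?_, ?_⟩, ?_⟩, hmin⟩, fun r => rfl⟩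
  · rw [← mul_concatCols, Matrix.mul_assoc, ← Matrix.mul_assoc _ W, hW.1, Matrix.one_mul, hPQ.1]
  · rw [← mul_concatCols, Matrix.mul_assoc, ← Matrix.mul_assoc Q, hPQ.2, Matrix.one_mul, hW.2]
  · rw [← mul_concatCols]
    simp only [Matrix.mul_assoc]

theorem IsPrimaryFactorization.isCoprime {R : ℕ} {q : 𝕜[X]} {p : Fin R → 𝕜[X]} {μ : Fin R → ℕ}
    (h : IsPrimaryFactorization q p μ) {r s : Fin R} (hrs : r ≠ s) :
    IsCoprime (p r ^ μ r) (p s ^ μ s) := by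
  obtain ⟨hmon, hirr, hinj, -, -⟩ := h
  refine IsCoprime.pow ((hirr r).coprime_iff_not_dvd.2 fun hd => hrs (hinj ?_))
  exact Polynomial.eq_of_monic_of_associated (hmon r) (hmon s)
    ((hirr r).associated_of_dvd (hirr s) hd)

/-- Rank factorisation of a projection onto a null space. -/
theorem exists_factor_projection {a l : ℕ} (K E : Matrix (Fin a) (Fin a) 𝕜)
    (hl : l = Module.finrank 𝕜 (LinearMap.ker K.mulVecLin)) (hKE : K * E = 0)
    (hE : ∀ v, K *ᵥ v = 0 → E *ᵥ v = v) :
    ∃ (S : Matrix (Fin a) (Fin l) 𝕜) (Y : Matrix (Fin l) (Fin a) 𝕜),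
      S * Y = E ∧ Y * S = 1 ∧ K * S = 0 := by
  -- In a basis of the null space, `S` is its inclusion `f` and `Y` is the projection `g` induced by
  -- `E`.
  let b : Module.Basis (Fin l) 𝕜 (LinearMap.ker K.mulVecLin) :=
    (Module.finBasisOfFinrankEq 𝕜 _ hl.symm)
  let f : (Fin l → 𝕜) →ₗ[𝕜] (Fin a → 𝕜) :=
    (LinearMap.ker K.mulVecLin).subtype ∘ₗ b.equivFun.symm.toLinearMap
  let g : (Fin a → 𝕜) →ₗ[𝕜] (Fin l → 𝕜) :=
    b.equivFun.toLinearMap ∘ₗ (LinearMap.codRestrict (LinearMap.ker K.mulVecLin) E.mulVecLin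
      fun v => by simp [Matrix.mulVec_mulVec, hKE])
  have hfg : f ∘ₗ g = Matrix.toLin' E := by
    refine LinearMap.ext fun v => ?_
    simp only [f, g, LinearMap.comp_apply, LinearEquiv.coe_coe, LinearEquiv.symm_apply_apply]
    rfl
  have hgf : g ∘ₗ f = LinearMap.id := by
    refine LinearMap.ext fun v => ?_
    simp only [f, g, LinearMap.comp_apply, LinearEquiv.coe_coe, Submodule.subtype_apply,
      LinearMap.id_apply]
    rw [← LinearEquiv.eq_symm_apply]
    exact Subtype.ext (hE _ (b.equivFun.symm v).2)
  refine ⟨LinearMap.toMatrix' f, LinearMap.toMatrix' g, ?_, ?_, ?_⟩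
  · rw [← LinearMap.toMatrix'_comp, hfg, LinearMap.toMatrix'_toLin']
  · rw [← LinearMap.toMatrix'_comp, hgf, LinearMap.toMatrix'_id]
  · apply (Matrix.toLin' (R := 𝕜)).injective
    rw [Matrix.toLin'_mul, Matrix.toLin'_toMatrix', map_zero]
    refine LinearMap.ext fun v => ?_
    exact (b.equivFun.symm v).2

/-- The polynomials that give the projections onto the primary components. -/
theorem exists_idempotents_of_isCoprime {R : ℕ} {P : Fin R → 𝕜[X]}
    (hcop : ∀ r s, r ≠ s → IsCoprime (P r) (P s)) :
    ∃ g : Fin R → 𝕜[X], (∀ r, P r ∣ g r - 1) ∧ (∀ r s, r ≠ s → P s ∣ g r) ∧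
      (∀ r, ∏ s, P s ∣ P r * g r) ∧ ∏ s, P s ∣ (∑ r, g r) - 1 := by
  have hidem : ∀ r, ∃ g : 𝕜[X], P r ∣ g - 1 ∧ ∏ s ∈ Finset.univ.erase r, P s ∣ g := by
    intro r
    obtain ⟨u, v, huv⟩ : IsCoprime (P r) (∏ s ∈ Finset.univ.erase r, P s) :=
      IsCoprime.prod_right fun s hs => hcop r s (Finset.ne_of_mem_erase hs).symm
    -- The second Bézout summand is 1 modulo `P r` and 0 modulo every other `P s`.
    exact ⟨v * ∏ s ∈ Finset.univ.erase r, P s, ⟨-u, by linear_combination huv⟩,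
      Dvd.intro_left v rfl⟩
  choose g hg1 hg0 using hidem
  have hg0' : ∀ r s, r ≠ s → P s ∣ g r := fun r s hrs =>
    (Finset.dvd_prod_of_mem _ (Finset.mem_erase.2 ⟨hrs.symm, Finset.mem_univ s⟩)).trans (hg0 r)
  refine ⟨g, hg1, hg0', fun r => ?_, ?_⟩
  · rw [← Finset.mul_prod_erase _ _ (Finset.mem_univ r)]
    exact mul_dvd_mul_left _ (hg0 r)
  · refine Finset.prod_dvd_of_coprime (fun r _ s _ hrs => hcop r s hrs) fun s _ => ?_
    rw [← Finset.add_sum_erase _ _ (Finset.mem_univ s), add_sub_right_comm]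
    exact dvd_add (hg1 s) (Finset.dvd_sum fun r hr => hg0' r s (Finset.ne_of_mem_erase hr))

/-- Each `minpoly 𝕜 (T s)` divides `p s ^ μ s`, as `S s` has a left inverse. Their product
annihilates `M`, so `p r ^ μ r` divides it; being coprime to the factors with `s ≠ r`, it divides
the factor of `T r`. -/
theorem minpoly_eq_of_primaryDecomposition {a R : ℕ} {M : Matrix (Fin a) (Fin a) 𝕜}
    {p : Fin R → 𝕜[X]} {μ : Fin R → ℕ} (hp : IsPrimaryFactorization (minpoly 𝕜 M) p μ)
    {l : Fin R → ℕ} {S : ∀ r, Matrix (Fin a) (Fin (l r)) 𝕜}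
    {Y : ∀ r, Matrix (Fin (l r)) (Fin a) 𝕜} {T : ∀ r, Matrix (Fin (l r)) (Fin (l r)) 𝕜}
    (hYS : ∀ r, Y r * S r = 1) (hone : ∑ r, S r * Y r = 1) (hMS : ∀ r, M * S r = S r * T r)
    (hKS : ∀ r, aeval M (p r ^ μ r) * S r = 0) (r : Fin R) :
    minpoly 𝕜 (T r) = p r ^ μ r := by
  have hcop : ∀ r s, r ≠ s → IsCoprime (p r ^ μ r) (p s ^ μ s) := fun r s => hp.isCoprime
  obtain ⟨hmon, -, -, -, hq⟩ := hp
  have hf : ∀ s (f : 𝕜[X]), aeval M f * S s = S s * aeval (T s) f := fun s =>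
    aeval_mul_eq_mul_aeval (hMS s)
  have hdvd : ∀ s, minpoly 𝕜 (T s) ∣ p s ^ μ s := by
    intro s
    rw [minpoly.dvd_iff]
    have h1 := hf s (p s ^ μ s)
    rw [hKS] at h1
    rw [← Matrix.one_mul (aeval _ _), ← hYS s, Matrix.mul_assoc, ← h1, Matrix.mul_zero]
  have hprod : minpoly 𝕜 M ∣ ∏ s, minpoly 𝕜 (T s) := by
    rw [minpoly.dvd_iff, ← Matrix.mul_one (aeval _ _), ← hone, Matrix.mul_sum]
    refine Finset.sum_eq_zero fun s _ => ?_
    rw [← Matrix.mul_assoc, hf, minpoly.dvd_iff.1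
      (Finset.dvd_prod_of_mem (fun s => minpoly 𝕜 (T s)) (Finset.mem_univ s)),
      Matrix.mul_zero, Matrix.zero_mul]
  refine Polynomial.eq_of_monic_of_associated (minpoly.monic (Matrix.isIntegral _))
    ((hmon r).pow _) (associated_of_dvd_dvd (hdvd r) ?_)
  have h2 : p r ^ μ r ∣ ∏ s, minpoly 𝕜 (T s) :=
    (Finset.dvd_prod_of_mem (fun r => p r ^ μ r) (Finset.mem_univ r)).trans (hq ▸ hprod)
  rw [← Finset.mul_prod_erase _ _ (Finset.mem_univ r)] at h2
  refine IsCoprime.dvd_of_dvd_mul_right (IsCoprime.prod_right fun s hs => ?_) h2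
  exact (hcop r s (Finset.ne_of_mem_erase hs).symm).of_isCoprime_of_dvd_right (hdvd s)

/-- The polynomials `g r` evaluated at `M` are complementary projections onto the null spaces.
Factoring them as `S r * Y r` gives the bases, and `T r = Y r * M * S r`. -/
theorem exists_primaryDecomposition {a R : ℕ} (M : Matrix (Fin a) (Fin a) 𝕜)
    {p : Fin R → 𝕜[X]} {μ : Fin R → ℕ} (hp : IsPrimaryFactorization (minpoly 𝕜 M) p μ)
    {l : Fin R → ℕ} (hl : ∀ r, l r = nullDim M (p r ^ μ r)) :
    ∃ (S : ∀ r, Matrix (Fin a) (Fin (l r)) 𝕜) (T : ∀ r, Matrix (Fin (l r)) (Fin (l r)) 𝕜),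
      IsPrimaryDecomposition M p μ S T := by
  obtain ⟨g, hg1, hg0, hgq, hgsum⟩ := exists_idempotents_of_isCoprime
    (P := fun r => p r ^ μ r) fun r s => hp.isCoprime
  rw [← hp.2.2.2.2] at hgsum
  have hsum : aeval M (∑ r, g r) = 1 := by
    have h := minpoly.dvd_iff.1 hgsum
    rwa [map_sub, map_one, sub_eq_zero] at h
  have hker : ∀ f h : 𝕜[X], minpoly 𝕜 M ∣ f * h → aeval M f * aeval M h = 0 := fun f h hd => by
    rw [← map_mul]; exact minpoly.dvd_iff.1 hd
  choose S Y hSY hYS hKS using fun r => exists_factor_projection (aeval M (p r ^ μ r))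
    (aeval M (g r)) (hl r)
    (hker _ _ (hp.2.2.2.2.symm ▸ hgq r))
    (fun v hv => by
      obtain ⟨c, hc⟩ := hg1 r
      rw [sub_eq_iff_eq_add] at hc
      rw [hc, mul_comm, map_add, map_mul, Matrix.add_mulVec, ← Matrix.mulVec_mulVec, hv]
      simp)
  have hYS0 : ∀ r s, r ≠ s → Y r * S s = 0 := by
    intro r s hrs
    obtain ⟨c, hc⟩ := hg0 r s hrs
    have h1 : S r * (Y r * S s) = 0 := by
      rw [← Matrix.mul_assoc, hSY, hc, mul_comm, map_mul, Matrix.mul_assoc, hKS, Matrix.mul_zero]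
    rw [← Matrix.one_mul (Y r * S s), ← hYS r, Matrix.mul_assoc, h1, Matrix.mul_zero]
  have hES : ∀ r, aeval M (g r) * S r = S r := fun r => by
    rw [← hSY, Matrix.mul_assoc, hYS, Matrix.mul_one]
  have hMS : ∀ r, M * S r = S r * (Y r * M * S r) := by
    intro r
    have hcomm : aeval M (g r) * M = M * aeval M (g r) := by
      have h := mul_comm (g r) X
      apply_fun aeval M at h
      simpa using h
    rw [Matrix.mul_assoc (Y r), ← Matrix.mul_assoc (S r), hSY, ← Matrix.mul_assoc, hcomm,
      Matrix.mul_assoc, hES]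
  have hone : ∑ r, S r * Y r = 1 := by
    simp only [hSY]
    rw [← map_sum, hsum]
  have hST : concatCols S * (concatCols fun r => (Y r)ᵀ)ᵀ = 1 := by
    simpa [concatCols_mul_transpose] using hone
  refine ⟨S, fun r => Y r * M * S r, ⟨(concatCols fun r => (Y r)ᵀ)ᵀ, ⟨hST, ?_⟩, ?_⟩, fun r => ?_⟩
  · ext ⟨r, k⟩ ⟨s, m⟩
    rw [transpose_concatCols_mul_apply, Matrix.transpose_transpose]
    by_cases hrs : r = s
    · subst hrs
      simp [hYS, Matrix.one_apply]
    · simp [hYS0 r s hrs, hrs]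
  · rw [concatCols_mul_blockDiagonal']
    simp only [← hMS]
    rw [← mul_concatCols, Matrix.mul_assoc, hST, Matrix.mul_one]
  · exact minpoly_eq_of_primaryDecomposition hp hYS hone hMS hKS r

end PrimaryDecomposition

end TensorSim

namespace TensorSim

open Matrix

/-! ### Mode products, unfoldings, slices, and the common minimal polynomial. -/

section TensorOperations

variable {𝕜 : Type*} [RCLike 𝕜] {N Nh : ℕ} {I : Fin N → ℕ}

theorem multiProd_multiProd {κ κ' κ'' : FirstMode N Nh → Type} [∀ n, Fintype (κ n)]
    [∀ n, Fintype (κ' n)] (Y : ∀ n, Matrix (κ'' n) (κ' n) 𝕜) (Z : ∀ n, Matrix (κ' n) (κ n) 𝕜)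
    (D : SplitTensor 𝕜 Nh I κ) :
    multiProd Y (multiProd Z D) = multiProd (fun n => Y n * Z n) D := by
  classical
  funext i t
  simp only [multiProd, Finset.mul_sum]
  rw [Finset.sum_comm]
  refine Finset.sum_congr rfl fun j _ => ?_
  simp only [Matrix.mul_apply, Finset.prod_univ_sum, Fintype.piFinset_univ, Finset.sum_mul,
    Finset.prod_mul_distrib]
  exact Finset.sum_congr rfl fun k _ => by ring

theorem multiProd_one {κ : FirstMode N Nh → Type} [∀ n, Fintype (κ n)] [∀ n, DecidableEq (κ n)]
    (D : SplitTensor 𝕜 Nh I κ) : multiProd (fun n => (1 : Matrix (κ n) (κ n) 𝕜)) D = D := by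
  funext i t
  simp only [multiProd]
  rw [Finset.sum_eq_single i]
  · simp
  · intro k _ hk
    obtain ⟨n, hn⟩ := Function.ne_iff.1 hk
    rw [Finset.prod_eq_zero (Finset.mem_univ n), zero_mul]
    exact Matrix.one_apply_ne hn.symm
  · simp

/-- Reduces the interaction of single and multiple mode products to the composition rule
`multiProd_multiProd`. -/
theorem modeProd_eq_multiProd {κ : FirstMode N Nh → Type} [∀ n, Fintype (κ n)]
    [∀ n, DecidableEq (κ n)] (n : FirstMode N Nh) (W : Matrix (κ n) (κ n) 𝕜)
    (D : SplitTensor 𝕜 Nh I κ) :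
    modeProd n W D =
      multiProd (Function.update (fun m => (1 : Matrix (κ m) (κ m) 𝕜)) n W) D := by
  funext i t
  refine Finset.sum_of_injOn (fun l => Function.update i n l)
    (fun _ _ _ _ h => Function.update_injective i n h) (fun _ _ => Finset.mem_coe.2 (Finset.mem_univ _))
    (fun k _ hk => ?_) (fun l _ => ?_)
  -- A multi-index that differs from `i` in some mode other than `n` meets an off-diagonal entry of
  -- an identity factor.
  · have : ∃ m, m ≠ n ∧ i m ≠ k m := by
      by_contra! h
      refine hk ⟨k n, by simp, ?_⟩
      funext m
      by_cases hm : m = n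
      · subst hm; simp
      · simp [hm, h m hm]
    obtain ⟨m, hm, hik⟩ := this
    rw [Finset.prod_eq_zero (Finset.mem_univ m), zero_mul]
    simp [hm, Matrix.one_apply_ne hik]
  · rw [← Finset.mul_prod_erase _ _ (Finset.mem_univ n), Finset.prod_eq_one]
    · simp
    · intro m hm
      simp [Finset.ne_of_mem_erase hm]

theorem modeProd_multiProd {κ κ' : FirstMode N Nh → Type} [∀ n, Fintype (κ n)]
    [∀ n, Fintype (κ' n)] [∀ n, DecidableEq (κ n)] [∀ n, DecidableEq (κ' n)]
    (n : FirstMode N Nh) (Y : ∀ n, Matrix (κ' n) (κ n) 𝕜) {W : Matrix (κ' n) (κ' n) 𝕜}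
    {Z : Matrix (κ n) (κ n) 𝕜} (h : W * Y n = Y n * Z) (D : SplitTensor 𝕜 Nh I κ) :
    modeProd n W (multiProd Y D) = multiProd Y (modeProd n Z D) := by
  rw [modeProd_eq_multiProd, modeProd_eq_multiProd, multiProd_multiProd, multiProd_multiProd]
  congr 1
  funext m
  by_cases hm : m = n
  · subst hm; simpa using h
  · simp [hm]

theorem modeProd_modeProd {κ : FirstMode N Nh → Type} [∀ n, Fintype (κ n)]
    (n : FirstMode N Nh) (W Z : Matrix (κ n) (κ n) 𝕜) (D : SplitTensor 𝕜 Nh I κ) :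
    modeProd n W (modeProd n Z D) = modeProd n (W * Z) D := by
  funext i t
  simp only [modeProd, Function.update_self, Function.update_idem, Matrix.mul_apply,
    Finset.mul_sum, Finset.sum_mul]
  rw [Finset.sum_comm]
  simp only [mul_assoc]

theorem modeProd_smul_one {κ : FirstMode N Nh → Type} [∀ n, Fintype (κ n)]
    [∀ n, DecidableEq (κ n)] (n : FirstMode N Nh) (c : 𝕜) (D : SplitTensor 𝕜 Nh I κ) :
    modeProd n (c • (1 : Matrix (κ n) (κ n) 𝕜)) D = c • D := by
  funext i t
  simp [modeProd, Matrix.one_apply]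

theorem modeProd_one {κ : FirstMode N Nh → Type} [∀ n, Fintype (κ n)]
    [∀ n, DecidableEq (κ n)] (n : FirstMode N Nh) (D : SplitTensor 𝕜 Nh I κ) :
    modeProd n (1 : Matrix (κ n) (κ n) 𝕜) D = D := by
  simpa using modeProd_smul_one n (1 : 𝕜) D

theorem mlTerm_smul {l : FirstMode N Nh → ℕ}
    (X : ∀ n : FirstMode N Nh, Matrix (Fin (I n.1)) (Fin (l n)) 𝕜) (c : 𝕜)
    (D : SplitTensor 𝕜 Nh I (fun n => Fin (l n))) : mlTerm X (c • D) = c • mlTerm X D := by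
  funext i
  simp [mlTerm, ofSplit, multiProd, Finset.mul_sum, mul_left_comm]

theorem ofSplit_toSplit {𝕜 : Type*} (A : Tensor 𝕜 I) : ofSplit (toSplit Nh A) = A := by
  funext i
  exact congrArg A ((Equiv.piEquivPiSubtypeProd (fun n : Fin N => n.val < Nh)
    (fun n => Fin (I n))).symm_apply_apply i)

theorem toSplit_ofSplit {𝕜 : Type*} (D : SplitTensor 𝕜 Nh I (fun n => Fin (I n.1))) :
    toSplit Nh (ofSplit D) = D := by
  funext i t
  have h := (Equiv.piEquivPiSubtypeProd (fun n : Fin N => n.val < Nh)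
    (fun n => Fin (I n))).apply_symm_apply (i, t)
  exact congrArg₂ D (congrArg Prod.fst h) (congrArg Prod.snd h)

theorem unfolding_injective {𝕜 : Type*} (n : Fin N) :
    Function.Injective fun A : Tensor 𝕜 I => unfolding A n := by
  intro A B h
  funext i
  have := congrFun (congrFun h fun m => i m.1) (i n)
  have hi := (Equiv.piSplitAt n (fun m => Fin (I m))).symm_apply_apply i
  exact (congrArg A hi).symm.trans (this.trans (congrArg B hi))

theorem unfolding_sum {ι : Type*} [Fintype ι] (A : ι → Tensor 𝕜 I) (n : Fin N) :
    unfolding (∑ r, A r) n = ∑ r, unfolding (A r) n := by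
  ext ρ i
  simp [unfolding, Matrix.sum_apply]

theorem unfolding_modeProd (n : FirstMode N Nh) (Y : Matrix (Fin (I n.1)) (Fin (I n.1)) 𝕜)
    (D : SplitTensor 𝕜 Nh I (fun n => Fin (I n.1))) :
    unfolding (ofSplit (modeProd n Yᵀ D)) n.1 = unfolding (ofSplit D) n.1 * Y := by
  ext ρ i
  simp only [unfolding, ofSplit, modeProd, Matrix.of_apply, Matrix.mul_apply,
    Matrix.transpose_apply]
  refine Finset.sum_congr rfl fun l _ => ?_
  rw [mul_comm]
  congr 1
  · congr 1
    · funext m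
      by_cases hm : m = n
      · subst hm; simp
      · have hm' : m.1 ≠ n.1 := fun h => hm (Subtype.ext h)
        simp [hm, hm']
    · funext m
      have hm' : m.1 ≠ n.1 := fun h => m.2 (h ▸ n.2)
      simp [hm']
  · simp

theorem eq_ofSplit_modeProd {A B : Tensor 𝕜 I} {n : FirstMode N Nh}
    {Y : Matrix (Fin (I n.1)) (Fin (I n.1)) 𝕜} (h : unfolding B n.1 = unfolding A n.1 * Y) :
    B = ofSplit (modeProd n Yᵀ (toSplit Nh A)) := by
  apply unfolding_injective n.1
  simp only
  rw [unfolding_modeProd, ofSplit_toSplit, h]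

/-- Transfers a matrix acting on the unfolding of a term to its core. It yields the sum for `B` and,
with suitable `Y` and `Z`, both rank estimates for terms. -/
theorem unfolding_mlTerm_mul {l : FirstMode N Nh → ℕ}
    (X : ∀ n : FirstMode N Nh, Matrix (Fin (I n.1)) (Fin (l n)) 𝕜)
    (D : SplitTensor 𝕜 Nh I (fun n => Fin (l n))) (n : FirstMode N Nh)
    {Y : Matrix (Fin (I n.1)) (Fin (I n.1)) 𝕜} {Z : Matrix (Fin (l n)) (Fin (l n)) 𝕜}
    (h : Yᵀ * X n = X n * Zᵀ) :
    unfolding (mlTerm X D) n.1 * Y = unfolding (mlTerm X (modeProd n Zᵀ D)) n.1 := by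
  rw [mlTerm, mlTerm, ← unfolding_modeProd, modeProd_multiProd n X h]

/-- The slice in the modes `n` and `m` of a tensor with separated indices. -/
def splitSlice {κ : FirstMode N Nh → Type} (D : SplitTensor 𝕜 Nh I κ) (n m : FirstMode N Nh)
    (b : ∀ n, κ n) (t : ∀ n : RestMode N Nh, Fin (I n.1)) : Matrix (κ n) (κ m) 𝕜 :=
  Matrix.of fun x y => D (Function.update (Function.update b n x) m y) t

theorem splitSlice_modeProd_left {κ : FirstMode N Nh → Type} [∀ n, Fintype (κ n)]
    (D : SplitTensor 𝕜 Nh I κ) {n m : FirstMode N Nh} (hnm : n ≠ m) (b : ∀ n, κ n)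
    (t : ∀ n : RestMode N Nh, Fin (I n.1)) (Y : Matrix (κ n) (κ n) 𝕜) :
    splitSlice (modeProd n Y D) n m b t = Y * splitSlice D n m b t := by
  ext x y
  simp only [splitSlice, modeProd, Matrix.of_apply, Matrix.mul_apply]
  refine Finset.sum_congr rfl fun l _ => ?_
  rw [Function.update_comm hnm.symm, Function.update_idem, Function.update_comm hnm]
  simp

theorem splitSlice_modeProd_right {κ : FirstMode N Nh → Type} [∀ n, Fintype (κ n)]
    (D : SplitTensor 𝕜 Nh I κ) {n m : FirstMode N Nh} (b : ∀ n, κ n)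
    (t : ∀ n : RestMode N Nh, Fin (I n.1)) (Y : Matrix (κ m) (κ m) 𝕜) :
    splitSlice (modeProd m Yᵀ D) n m b t = splitSlice D n m b t * Y := by
  ext x y
  simp only [splitSlice, modeProd, Matrix.of_apply, Matrix.mul_apply, Function.update_idem,
    Function.update_self, Matrix.transpose_apply]
  exact Finset.sum_congr rfl fun l _ => mul_comm _ _

theorem slice_eq_splitSlice {𝕜 : Type*} (A : Tensor 𝕜 I) (n m : FirstMode N Nh) (b : ∀ n, Fin (I n)) :
    slice A n.1 m.1 b = splitSlice (toSplit Nh A) n m (fun n => b n.1) (fun n => b n.1) := by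
  ext x y
  simp only [slice, splitSlice, toSplit, Matrix.of_apply]
  congr 1
  funext k
  by_cases hk : k.val < Nh
  · by_cases h1 : k = m.1
    · subst h1
      simpa using fun h => absurd hk (not_lt.2 h)
    · have h1' : (⟨k, hk⟩ : FirstMode N Nh) ≠ m := fun h => h1 (congrArg Subtype.val h)
      by_cases h2 : k = n.1
      · subst h2
        simpa [h1, h1'] using fun h => absurd hk (not_lt.2 h)
      · have h2' : (⟨k, hk⟩ : FirstMode N Nh) ≠ n := fun h => h2 (congrArg Subtype.val h)
        simp [h1, h1', h2, h2', hk]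
  · have h1 : k ≠ m.1 := fun h => hk (h ▸ m.2)
    have h2 : k ≠ n.1 := fun h => hk (h ▸ n.2)
    simp [h1, h2, hk]

/-- Both sides are the slice of `B` through `b`, computed from `A` by a mode-`n` product on the left
and by a mode-`m` product on the right. -/
theorem transpose_mul_slice_eq {A B : Tensor 𝕜 I}
    {M : ∀ n : FirstMode N Nh, Matrix (Fin (I n.1)) (Fin (I n.1)) 𝕜}
    (hB : ∀ n : FirstMode N Nh, unfolding B n.1 = unfolding A n.1 * M n) {n m : FirstMode N Nh}
    (hnm : n ≠ m) (b : ∀ n, Fin (I n)) :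
    (M n)ᵀ * slice A n.1 m.1 b = slice A n.1 m.1 b * M m := by
  have h1 := congrArg (toSplit Nh) (eq_ofSplit_modeProd (hB n))
  have h2 := congrArg (toSplit Nh) (eq_ofSplit_modeProd (hB m))
  rw [toSplit_ofSplit] at h1 h2
  rw [slice_eq_splitSlice]
  refine (splitSlice_modeProd_left (toSplit Nh A) hnm _ _ (M n)ᵀ).symm.trans ?_
  rw [← h1, h2]
  exact splitSlice_modeProd_right _ _ _ _

theorem eq_zero_of_mul_eq_zero_of_rank_eq {α : Type*} {a b : ℕ} {P : Matrix α (Fin a) 𝕜}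
    (hP : P.rank = a) {Y : Matrix (Fin a) (Fin b) 𝕜} (h : P * Y = 0) : Y = 0 := by
  have hker : LinearMap.ker P.mulVecLin = ⊥ := by
    have := LinearMap.finrank_range_add_finrank_ker P.mulVecLin
    rw [Module.finrank_fin_fun] at this
    rw [← Submodule.finrank_eq_zero (R := 𝕜)]
    rw [Matrix.rank] at hP
    omega
  ext i j
  have h1 : P.mulVecLin (Y.col j) = 0 := by
    ext ρ
    exact congrFun (congrFun h ρ) j
  exact congrFun (LinearMap.ker_eq_bot'.1 hker _ h1) i

/-- The minimal polynomial of `M n`, evaluated at `M m`, kills all slices from the right, hence all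
rows of the mode-`m` unfolding; full column rank makes it zero. -/
theorem minpoly_dvd_minpoly {A B : Tensor 𝕜 I}
    {M : ∀ n : FirstMode N Nh, Matrix (Fin (I n.1)) (Fin (I n.1)) 𝕜}
    (hA : ∀ n : FirstMode N Nh, (unfolding A n.1).rank = I n.1)
    (hB : ∀ n : FirstMode N Nh, unfolding B n.1 = unfolding A n.1 * M n) (n m : FirstMode N Nh) :
    minpoly 𝕜 (M m) ∣ minpoly 𝕜 (M n) := by
  rcases eq_or_ne n m with rfl | hnm
  · rfl
  rw [minpoly.dvd_iff]
  refine eq_zero_of_mul_eq_zero_of_rank_eq (hA m) ?_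
  ext ρ y
  -- Row `ρ` of the unfolding is row `b n` of the slice through `b`; the mode-`m` entry `y` of `b`
  -- is immaterial there.
  set b : ∀ n, Fin (I n) := (Equiv.piSplitAt m.1 (fun m => Fin (I m))).symm (y, ρ) with hb
  have h := aeval_mul_eq_mul_aeval (transpose_mul_slice_eq hB hnm b) (minpoly 𝕜 (M n))
  rw [aeval_transpose, minpoly.aeval, Matrix.transpose_zero, Matrix.zero_mul] at h
  have h' := (congrFun (congrFun h (b n.1)) y).symm
  rw [Matrix.mul_apply] at h' ⊢
  refine Eq.trans (Finset.sum_congr rfl fun l _ => ?_) h'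
  congr 1
  simp only [unfolding, slice, Matrix.of_apply, Function.update_eq_self]
  congr 1
  funext k
  by_cases hk : k = m.1
  · subst hk; simp
  · simp [hb, hk]

end TensorOperations

end TensorSim

namespace TensorSim

open Polynomial Matrix

/-! ### Block structure of the core tensor; auxiliary rank and polynomial facts. -/

section BlockDecomposition

variable {𝕜 : Type*} [RCLike 𝕜]

theorem submatrix_transpose_blockDiagonal'_mul {R : ℕ} {L : Fin R → ℕ} {β : Type*}
    (T : ∀ r, Matrix (Fin (L r)) (Fin (L r)) 𝕜) (C : Matrix (Σ r, Fin (L r)) β 𝕜) (r : Fin R) :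
    ((Matrix.blockDiagonal' T)ᵀ * C).submatrix (Sigma.mk r) id =
      (T r)ᵀ * C.submatrix (Sigma.mk r) id := by
  ext k y
  simp only [Matrix.submatrix_apply, Matrix.mul_apply, Matrix.transpose_apply,
    Fintype.sum_sigma, id]
  rw [Finset.sum_eq_single r]
  · simp [Matrix.blockDiagonal'_apply_eq]
  · intro s _ hs
    exact Finset.sum_eq_zero fun l _ => by rw [Matrix.blockDiagonal'_apply_ne _ _ _ hs, zero_mul]
  · simp

variable {N Nh R : ℕ} {I : Fin N → ℕ} {L : FirstMode N Nh → Fin R → ℕ}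

theorem diagBlock_modeProd (n : FirstMode N Nh) (T : ∀ r, Matrix (Fin (L n r)) (Fin (L n r)) 𝕜)
    (D : SplitTensor 𝕜 Nh I (fun n => Σ r : Fin R, Fin (L n r))) (r : Fin R) :
    diagBlock (modeProd n (Matrix.blockDiagonal' T)ᵀ D) r =
      modeProd n (T r)ᵀ (diagBlock D r) := by
  funext k t
  simp only [diagBlock, modeProd, Matrix.transpose_apply, Fintype.sum_sigma]
  rw [Finset.sum_eq_single r]
  · refine Finset.sum_congr rfl fun l _ => ?_
    rw [Matrix.blockDiagonal'_apply_eq]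
    congr 2
    funext m
    by_cases hm : m = n
    · subst hm; simp
    · simp [hm]
  · intro s _ hs
    exact Finset.sum_eq_zero fun l _ => by rw [Matrix.blockDiagonal'_apply_ne _ _ _ hs, zero_mul]
  · simp

/-- If two indices of an entry lie in blocks with different numbers, the entry sits in a slice block
intertwining two matrices with coprime annihilators. -/
theorem isBlockDiagonal_of_modeProd_eq [Nonempty (FirstMode N Nh)]
    {D : SplitTensor 𝕜 Nh I (fun n => Σ r : Fin R, Fin (L n r))}
    {T : ∀ n r, Matrix (Fin (L n r)) (Fin (L n r)) 𝕜}
    (hD : ∀ n m, modeProd n (Matrix.blockDiagonal' (T n))ᵀ D =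
      modeProd m (Matrix.blockDiagonal' (T m))ᵀ D)
    {P : Fin R → 𝕜[X]} (hP : ∀ r s, r ≠ s → IsCoprime (P r) (P s))
    (hT : ∀ n r, aeval (T n r) (P r) = 0) : IsBlockDiagonal D := by
  intro k t hk
  obtain ⟨n⟩ := ‹Nonempty (FirstMode N Nh)›
  obtain ⟨m, hm⟩ : ∃ m, (k m).1 ≠ (k n).1 := by
    by_contra! h
    exact hk ⟨_, h⟩
  have hnm : n ≠ m := by rintro rfl; exact hm rfl
  have h1 := splitSlice_modeProd_left D hnm k t (Matrix.blockDiagonal' (T n))ᵀ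
  rw [hD n m, splitSlice_modeProd_right] at h1
  have h2 := submatrix_transpose_blockDiagonal'_mul (T m) (splitSlice D n m k t)ᵀ (k m).1
  rw [← Matrix.transpose_mul, h1] at h2
  have h3 := submatrix_transpose_blockDiagonal'_mul (T n) (splitSlice D n m k t) (k n).1
  have h4 : (T n (k n).1)ᵀ * (splitSlice D n m k t).submatrix (Sigma.mk (k n).1)
      (Sigma.mk (k m).1) = (splitSlice D n m k t).submatrix (Sigma.mk (k n).1)
      (Sigma.mk (k m).1) * T m (k m).1 := by
    have h2' := congrArg (fun Z => (Z.submatrix id (Sigma.mk (k n).1))ᵀ) h2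
    have h3' := congrArg (fun Z => Z.submatrix id (Sigma.mk (k m).1)) h3
    ext x y
    have e2 := congrFun (congrFun h2' x) y
    have e3 := congrFun (congrFun h3' x) y
    refine e3.symm.trans (e2.trans ?_)
    simp [Matrix.mul_apply, mul_comm]
  have h5 := eq_zero_of_isCoprime_annihilators h4 (hP _ _ hm.symm)
    (by rw [aeval_transpose, hT, Matrix.transpose_zero]) (hT _ _)
  have h6 := congrFun (congrFun h5 (k n).2) (k m).2
  simpa [splitSlice] using h6

/-- Only multi-indices with a common block number contribute. That number can be read off any mode,
so at least one mode is needed to avoid counting terms twice. -/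
theorem multiProd_concatCols [Nonempty (FirstMode N Nh)]
    (X : ∀ (n : FirstMode N Nh) (r : Fin R), Matrix (Fin (I n.1)) (Fin (L n r)) 𝕜)
    {D : SplitTensor 𝕜 Nh I (fun n => Σ r : Fin R, Fin (L n r))} (hD : IsBlockDiagonal D) :
    ofSplit (multiProd (fun n => concatCols (X n)) D) =
      ∑ r, mlTerm (fun n => X n r) (diagBlock D r) := by
  funext i
  simp only [ofSplit, mlTerm, Finset.sum_apply, multiProd, diagBlock]
  rw [← Fintype.sum_sigma (fun x : Σ r : Fin R, ∀ n, Fin (L n r) =>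
    (∏ n, X n x.1 (i n.1) (x.2 n)) * D (fun n => ⟨x.1, x.2 n⟩) (fun n => i n.1))]
  symm
  refine Finset.sum_of_injOn
    (fun (x : Σ r : Fin R, ∀ n, Fin (L n r)) n => (⟨x.1, x.2 n⟩ : Σ r : Fin R, Fin (L n r)))
    ?_ (fun _ _ => Finset.mem_coe.2 (Finset.mem_univ _)) (fun k _ hk => ?_) (fun x _ => rfl)
  · rintro ⟨r, k⟩ - ⟨s, l⟩ - h
    obtain ⟨n⟩ := ‹Nonempty (FirstMode N Nh)›
    obtain rfl : r = s := congrArg Sigma.fst (congrFun h n)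
    congr 1
    funext m
    simpa using congrFun h m
  · rw [hD k _, mul_zero]
    rintro ⟨r, hr⟩
    have hsig : ∀ n (x : Σ r : Fin R, Fin (L n r)), x.1 = r → ∃ l, ⟨r, l⟩ = x := by
      rintro n ⟨_, l⟩ rfl
      exact ⟨l, rfl⟩
    choose l hl using fun n => hsig n (k n) (hr n)
    exact hk ⟨⟨r, l⟩, by simp, funext hl⟩

/-- The right-hand side does not depend on `n`, so the products in all modes agree. -/
theorem modeProd_coreTensor {A B : Tensor 𝕜 I}
    {M : ∀ n : FirstMode N Nh, Matrix (Fin (I n.1)) (Fin (I n.1)) 𝕜}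
    (hB : ∀ n : FirstMode N Nh, unfolding B n.1 = unfolding A n.1 * M n)
    {S : ∀ (n : FirstMode N Nh) (r : Fin R), Matrix (Fin (I n.1)) (Fin (L n r)) 𝕜}
    {T : ∀ n r, Matrix (Fin (L n r)) (Fin (L n r)) 𝕜}
    (hMS : ∀ n r, M n * S n r = S n r * T n r) (n : FirstMode N Nh) :
    modeProd n (Matrix.blockDiagonal' (T n))ᵀ (coreTensor A S) = coreTensor B S := by
  have h := congrArg (toSplit Nh) (eq_ofSplit_modeProd (hB n))
  rw [toSplit_ofSplit] at h
  rw [coreTensor, coreTensor, h]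
  refine modeProd_multiProd n _ ?_ _
  rw [← Matrix.transpose_mul, ← Matrix.transpose_mul, concatCols_mul_blockDiagonal',
    mul_concatCols]
  simp only [hMS]

theorem rank_sum_le {α ι : Type*} [Fintype ι] {a : ℕ} (A : ι → Matrix α (Fin a) 𝕜) :
    (∑ r, A r).rank ≤ ∑ r, (A r).rank := by
  classical
  have : ∀ s : Finset ι, (∑ r ∈ s, A r).rank ≤ ∑ r ∈ s, (A r).rank := by
    intro s
    induction s using Finset.induction_on with
    | empty => simp
    | insert r s hr ih =>
      rw [Finset.sum_insert hr, Finset.sum_insert hr]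
      refine le_trans ?_ (Nat.add_le_add_left ih _)
      refine le_trans (Submodule.finrank_mono (t := LinearMap.range (A r).mulVecLin ⊔
        LinearMap.range (∑ r ∈ s, A r).mulVecLin) ?_)
        (Submodule.finrank_add_le_finrank_add_finrank _ _)
      rintro _ ⟨v, rfl⟩
      rw [Matrix.mulVecLin_apply, Matrix.add_mulVec]
      exact Submodule.add_mem_sup ⟨v, rfl⟩ ⟨v, rfl⟩
  exact this Finset.univ

/-- `X` is coprime to `p ^ k`; its Bézout coefficient, evaluated at `T`, is the inverse. -/
theorem isUnit_of_minpoly_eq_pow {l k : ℕ} {T : Matrix (Fin l) (Fin l) 𝕜} {p : 𝕜[X]}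
    (hp : Irreducible p) (hmon : p.Monic) (hX : p ≠ X) (hT : minpoly 𝕜 T = p ^ k) :
    ∃ Q : Matrix (Fin l) (Fin l) 𝕜, T * Q = 1 := by
  have hcop : IsCoprime X (p ^ k) := by
    refine IsCoprime.pow_right ((irreducible_X.coprime_iff_not_dvd).2 fun hd => hX ?_)
    exact Polynomial.eq_of_monic_of_associated hmon monic_X
      (irreducible_X.associated_of_dvd hp hd).symm
  obtain ⟨u, v, huv⟩ := hcop
  refine ⟨aeval T u, ?_⟩
  have := congrArg (aeval T) huv
  rwa [← hT, map_add, map_mul, map_mul, minpoly.aeval, mul_zero, add_zero, aeval_X, map_one,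
    mul_eq_one_comm] at this

theorem eq_zero_iff_of_minpoly_smul_one {l k : ℕ} {c : 𝕜} {p : 𝕜[X]} (hp : Irreducible p)
    (hmon : p.Monic) (hk : 1 ≤ k)
    (hT : minpoly 𝕜 (c • (1 : Matrix (Fin l) (Fin l) 𝕜)) = p ^ k) : c = 0 ↔ p = X := by
  have hd : p ∣ X - C c := by
    refine (dvd_pow_self p (by omega)).trans (hT ▸ minpoly.dvd_iff.2 ?_)
    simp [Algebra.algebraMap_eq_smul_one]
  have hpc : p = X - C c := Polynomial.eq_of_monic_of_associated hmon (monic_X_sub_C c)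
    (hp.associated_of_dvd (irreducible_X_sub_C c) hd)
  rw [hpc]
  simp

end BlockDecomposition

end TensorSim

namespace TensorSim

open Polynomial Matrix

/-! ### The terms of the decompositions, their ranks, and similarity from slices. -/

section Terms

variable {𝕜 : Type*} [RCLike 𝕜] {N Nh R : ℕ} {I : Fin N → ℕ} {L : FirstMode N Nh → Fin R → ℕ}

theorem AreInverse.transpose_mul_self_eq_one {a : ℕ} {l : Fin R → ℕ}
    {S X : ∀ r, Matrix (Fin a) (Fin (l r)) 𝕜}
    (h : AreInverse (concatCols S) (concatCols X)ᵀ) (r : Fin R) : (S r)ᵀ * X r = 1 := by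
  have h1 : (X r)ᵀ * S r = 1 := by
    ext k m
    rw [← transpose_concatCols_mul_apply, h.2]
    simp [Matrix.one_apply]
  rw [← Matrix.transpose_transpose (X r), ← Matrix.transpose_mul, h1, Matrix.transpose_one]

/-- `Mᵀ X_r = X_r T_rᵀ`, the transposed form of `M S_r = S_r T_r`. -/
theorem transpose_mul_eq_mul_transpose {a : ℕ} {l : Fin R → ℕ} {M : Matrix (Fin a) (Fin a) 𝕜}
    {S X : ∀ r, Matrix (Fin a) (Fin (l r)) 𝕜} {T : ∀ r, Matrix (Fin (l r)) (Fin (l r)) 𝕜}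
    (h : AreInverse (concatCols S) (concatCols X)ᵀ) (hMS : ∀ r, M * S r = S r * T r)
    (r : Fin R) : Mᵀ * X r = X r * (T r)ᵀ := by
  have h1 : M = concatCols S * Matrix.blockDiagonal' T * (concatCols X)ᵀ := by
    rw [concatCols_mul_blockDiagonal']
    simp only [← hMS]
    rw [← mul_concatCols, Matrix.mul_assoc, h.1, Matrix.mul_one]
  have h2 : Mᵀ * concatCols X = concatCols X * Matrix.blockDiagonal' fun r => (T r)ᵀ := by
    rw [← Matrix.blockDiagonal'_transpose, ← Matrix.transpose_transpose (concatCols X),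
      ← Matrix.transpose_mul, ← Matrix.transpose_mul, h1, ← Matrix.mul_assoc, ← Matrix.mul_assoc,
      h.2, Matrix.one_mul]
  rw [mul_concatCols, concatCols_mul_blockDiagonal'] at h2
  exact concatCols_injective h2 r

theorem sum_termA [Nonempty (FirstMode N Nh)] (A : Tensor 𝕜 I)
    {S X : ∀ (n : FirstMode N Nh) (r : Fin R), Matrix (Fin (I n.1)) (Fin (L n r)) 𝕜}
    (hSX : ∀ n, AreInverse (concatCols (S n)) (concatCols (X n))ᵀ)
    (hD : IsBlockDiagonal (coreTensor A S)) : A = ∑ r, termA A S X r := by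
  have h := multiProd_concatCols X hD
  rw [coreTensor, multiProd_multiProd] at h
  have h1 : ∀ n, concatCols (X n) * (concatCols (S n))ᵀ = 1 := fun n => by
    rw [← Matrix.transpose_transpose (concatCols (X n)), ← Matrix.transpose_mul, (hSX n).1,
      Matrix.transpose_one]
  simp only [h1] at h
  rw [multiProd_one, ofSplit_toSplit] at h
  exact h

/-- The unfolding is fixed by right multiplication with `S n * (X n)ᵀ`, which factors through
dimension `l n`. -/
theorem rank_unfolding_mlTerm_le {l : FirstMode N Nh → ℕ}
    {S X : ∀ n : FirstMode N Nh, Matrix (Fin (I n.1)) (Fin (l n)) 𝕜}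
    (D : SplitTensor 𝕜 Nh I (fun n => Fin (l n))) (n : FirstMode N Nh)
    (hSX : (S n)ᵀ * X n = 1) : (unfolding (mlTerm X D) n.1).rank ≤ l n := by
  have h := unfolding_mlTerm_mul X D n (Y := S n * (X n)ᵀ) (Z := 1) (by
    rw [Matrix.transpose_mul, Matrix.transpose_transpose, Matrix.mul_assoc, hSX,
      Matrix.transpose_one])
  rw [Matrix.transpose_one, modeProd_one] at h
  rw [← h, ← Matrix.mul_assoc]
  refine (Matrix.rank_mul_le_right _ _).trans ?_
  simpa using Matrix.rank_le_card_height (X n)ᵀ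

/-- Subadditivity of rank gives `∑ s, L n s = I n ≤ ∑ s, rank`, while each rank is at most `L n s`;
hence equality holds termwise. -/
theorem isMLRank_termA [Nonempty (FirstMode N Nh)] {A : Tensor 𝕜 I}
    (hA : ∀ n : FirstMode N Nh, (unfolding A n.1).rank = I n.1)
    {S X : ∀ (n : FirstMode N Nh) (r : Fin R), Matrix (Fin (I n.1)) (Fin (L n r)) 𝕜}
    (hSX : ∀ n, AreInverse (concatCols (S n)) (concatCols (X n))ᵀ)
    (hD : IsBlockDiagonal (coreTensor A S)) (r : Fin R) :
    IsMLRank (termA A S X r) (fun n => L n r) := by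
  intro n
  have hle : ∀ s, (unfolding (termA A S X s) n.1).rank ≤ L n s := fun s =>
    rank_unfolding_mlTerm_le (S := fun n => S n s) _ n ((hSX n).transpose_mul_self_eq_one s)
  have hsum : ∑ s, L n s ≤ ∑ s, (unfolding (termA A S X s) n.1).rank := by
    have hI : I n.1 = ∑ s, L n s := by simpa using (hSX n).card_eq
    have hsub := rank_sum_le fun s => unfolding (termA A S X s) n.1
    rw [← unfolding_sum, ← sum_termA A hSX hD, hA n] at hsub
    exact hI.symm.trans_le hsub
  exact (Finset.sum_eq_sum_iff_of_le fun s _ => hle s).1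
    (le_antisymm (Finset.sum_le_sum fun s _ => hle s) hsum) r (Finset.mem_univ r)

/-- Right multiplication by `S n r * Q * (X n r)ᵀ` undoes the factor `T n r` and turns the term of
`B` back into that of `A`. -/
theorem rank_unfolding_termA_le_termB {A : Tensor 𝕜 I}
    {S X : ∀ (n : FirstMode N Nh) (r : Fin R), Matrix (Fin (I n.1)) (Fin (L n r)) 𝕜}
    {T : ∀ n r, Matrix (Fin (L n r)) (Fin (L n r)) 𝕜} {r : Fin R} {n : FirstMode N Nh}
    (hSX : (S n r)ᵀ * X n r = 1) {Q : Matrix (Fin (L n r)) (Fin (L n r)) 𝕜}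
    (hQ : T n r * Q = 1) :
    (unfolding (termA A S X r) n.1).rank ≤ (unfolding (termB n A S T X r) n.1).rank := by
  have h := unfolding_mlTerm_mul (fun n => X n r)
    (modeProd n (T n r)ᵀ (diagBlock (coreTensor A S) r)) n (Y := S n r * Q * (X n r)ᵀ) (Z := Q) (by
      rw [Matrix.transpose_mul, Matrix.transpose_mul, Matrix.transpose_transpose,
        Matrix.mul_assoc, Matrix.mul_assoc, hSX, Matrix.mul_one])
  rw [modeProd_modeProd, ← Matrix.transpose_mul, hQ, Matrix.transpose_one, modeProd_one] at h
  rw [termA, termB, ← h]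
  exact Matrix.rank_mul_le_left _ _

/-- With `G` a similarity between `M` and its transpose, `G⁻¹ * C` intertwines `M` and `M'`. -/
theorem matSimilar_transpose_self {a b : ℕ} {M : Matrix (Fin a) (Fin a) 𝕜}
    {M' : Matrix (Fin b) (Fin b) 𝕜} (h : a = b) (C : Matrix (Fin a) (Fin b) 𝕜)
    (hC : (C.submatrix id (Fin.cast h)).det ≠ 0) (hMC : Mᵀ * C = C * M') : MatSimilar M M' := by
  subst h
  obtain ⟨G, hG, hMG⟩ := exists_det_ne_zero_transpose_mul_eq M
  have hG' : IsUnit G.det := isUnit_iff_ne_zero.2 hG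
  refine matSimilar_of_mul_eq_mul rfl (G⁻¹ * C) ?_ ?_
  · change (G⁻¹ * C).det ≠ 0
    rw [Matrix.det_mul]
    exact mul_ne_zero (Matrix.isUnit_nonsing_inv_det G hG').ne_zero hC
  · have h1 : M * G⁻¹ = G⁻¹ * Mᵀ := by
      calc M * G⁻¹ = G⁻¹ * (G * M) * G⁻¹ := by
            rw [← Matrix.mul_assoc, Matrix.nonsing_inv_mul G hG', Matrix.one_mul]
        _ = G⁻¹ * Mᵀ := by
            rw [← hMG, Matrix.mul_assoc, Matrix.mul_assoc, Matrix.mul_nonsing_inv G hG',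
              Matrix.mul_one]
    rw [← Matrix.mul_assoc, h1, Matrix.mul_assoc, hMC, Matrix.mul_assoc]

end Terms

end TensorSim

/-! ### The main theorem. -/

open TensorSim
theorem mainTheorem1 {𝕜 : Type*} [RCLike 𝕜] (N Nh : ℕ) (_hN : 3 ≤ N) (hNh : 2 ≤ Nh) (hle : Nh ≤ N)
    (I : Fin N → ℕ) (A B : Tensor 𝕜 I)
    (M : ∀ n : FirstMode N Nh, Matrix (Fin (I n.1)) (Fin (I n.1)) 𝕜)
    (_hA : ∀ n : FirstMode N Nh, (unfolding A n.1).rank = I n.1)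
    (_hB : ∀ n : FirstMode N Nh, unfolding B n.1 = unfolding A n.1 * M n) :
    -- the minimal polynomials coincide
    (∀ i j, minpoly 𝕜 (M i) = minpoly 𝕜 (M j)) ∧
    -- a nonsingular linear combination of the `(i, j)`-slices makes `M i` and `M j` similar
    (∀ i j : FirstMode N Nh, i ≠ j → ∀ h : I i.1 = I j.1,
      (∃ C ∈ Submodule.span 𝕜 (Set.range (slice A i.1 j.1)),
        (C.submatrix id (Fin.cast h)).det ≠ 0) →
      MatSimilar (M i) (M j)) ∧
    -- the consequences of a factorization of the common minimal polynomial `q`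
    ∀ (q : Polynomial 𝕜), (∀ n, minpoly 𝕜 (M n) = q) →
    ∀ (R : ℕ) (p : Fin R → Polynomial 𝕜) (μ : Fin R → ℕ), IsPrimaryFactorization q p μ →
    ∀ L : FirstMode N Nh → Fin R → ℕ, (∀ n r, L n r = nullDim (M n) (p r ^ μ r)) →
      -- if `M i` and `M j` are similar, the primary decompositions can be chosen with equal blocks
      (∀ i j, MatSimilar (M i) (M j) →
        ∃ h : ∀ r, L i r = L j r,
        ∃ (S : ∀ n r, Matrix (Fin (I n.1)) (Fin (L n r)) 𝕜)
          (T : ∀ n r, Matrix (Fin (L n r)) (Fin (L n r)) 𝕜),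
          (∀ n, IsPrimaryDecomposition (M n) p μ (S n) (T n)) ∧
          ∀ r, T i r = (T j r).submatrix (Fin.cast (h r)) (Fin.cast (h r))) ∧
      -- for all primary decompositions
      ∀ (S : ∀ n r, Matrix (Fin (I n.1)) (Fin (L n r)) 𝕜)
        (T : ∀ n r, Matrix (Fin (L n r)) (Fin (L n r)) 𝕜),
        (∀ n, IsPrimaryDecomposition (M n) p μ (S n) (T n)) →
        -- the core tensor is block diagonal, and its blocks intertwine the `T n r`
        IsBlockDiagonal (coreTensor A S) ∧
        (∀ r n m, modeProd n (T n r).transpose (diagBlock (coreTensor A S) r) =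
          modeProd m (T m r).transpose (diagBlock (coreTensor A S) r)) ∧
        -- with `X n` the transposed inverse of `S n`
        ∀ X : ∀ n r, Matrix (Fin (I n.1)) (Fin (L n r)) 𝕜,
          (∀ n, AreInverse (concatCols (S n)) (concatCols (X n)).transpose) →
          -- the decompositions of `A` and `B`
          (A = ∑ r, termA A S X r ∧
            ∀ r, IsMLRank (termA A S X r) (fun n => L n r)) ∧
          (B = ∑ r, termB (modeOne hNh hle) A S T X r ∧
            (∀ r (n : FirstMode N Nh),
              (unfolding (termB (modeOne hNh hle) A S T X r) n.1).rank ≤ L n r) ∧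
            (∀ r, p r ≠ Polynomial.X →
              IsMLRank (termB (modeOne hNh hle) A S T X r) (fun n => L n r))) ∧
          -- scalar blocks give proportional terms
          (∀ r n (c : 𝕜), T n r = c • (1 : Matrix (Fin (L n r)) (Fin (L n r)) 𝕜) →
            termB (modeOne hNh hle) A S T X r = c • termA A S X r) ∧
          -- if for every `r` some block is scalar, then `B` is made of the scaled terms of `A`
          (∀ c : Fin R → 𝕜,
            (∀ r, ∃ n, T n r = c r • (1 : Matrix (Fin (L n r)) (Fin (L n r)) 𝕜)) →
            B = ∑ r, c r • termA A S X r ∧ ∀ r, c r = 0 ↔ p r = Polynomial.X) := by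
  have : Nonempty (FirstMode N Nh) := ⟨modeOne hNh hle⟩
  have hmin : ∀ i j, minpoly 𝕜 (M i) = minpoly 𝕜 (M j) := fun i j =>
    Polynomial.eq_of_monic_of_associated (minpoly.monic (Matrix.isIntegral _))
      (minpoly.monic (Matrix.isIntegral _))
      (associated_of_dvd_dvd (minpoly_dvd_minpoly _hA _hB j i) (minpoly_dvd_minpoly _hA _hB i j))
  refine ⟨hmin, fun i j hij h ⟨C, hC, hdet⟩ => ?_, ?_⟩
  · refine matSimilar_transpose_self h C hdet ?_
    clear hdet
    -- The intertwining relation is linear in `C`, so it passes from slices to their combinations.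
    induction hC using Submodule.span_induction with
    | mem C hC =>
      obtain ⟨b, rfl⟩ := hC
      exact transpose_mul_slice_eq _hB hij b
    | zero => simp
    | add C C' _ _ hC hC' => rw [Matrix.mul_add, Matrix.add_mul, hC, hC']
    | smul c C _ hC => rw [Matrix.mul_smul, Matrix.smul_mul, hC]
  intro q hq R p μ hp L hL
  refine ⟨fun i j hij => ?_, fun S T hST => ?_⟩
  · have h : ∀ r, L i r = L j r := fun r => by rw [hL, hL, hij.nullDim_eq]
    obtain ⟨Sj, Tj, hj⟩ := exists_primaryDecomposition (M j) ((hq j).symm ▸ hp) (hL j)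
    rcases eq_or_ne i j with rfl | hne
    · choose S T hST using fun n =>
        exists_primaryDecomposition (M n) ((hq n).symm ▸ hp) (hL n)
      exact ⟨h, S, T, hST, fun r => rfl⟩
    · obtain ⟨Si, Ti, hi, hTi⟩ := hj.of_matSimilar hij h
      -- A family prescribed at `i` and `j` and arbitrary elsewhere; the transports along `e` record
      -- the prescribed values.
      have hex : ∀ n, ∃ (S : ∀ r, Matrix (Fin (I n.1)) (Fin (L n r)) 𝕜)
          (T : ∀ r, Matrix (Fin (L n r)) (Fin (L n r)) 𝕜), IsPrimaryDecomposition (M n) p μ S T ∧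
          (∀ e : n = i, e ▸ T = Ti) ∧ (∀ e : n = j, e ▸ T = Tj) := by
        intro n
        by_cases hni : n = i
        · subst hni
          exact ⟨Si, Ti, hi, fun _ => rfl, fun e => absurd e hne⟩
        · by_cases hnj : n = j
          · subst hnj
            exact ⟨Sj, Tj, hj, fun e => absurd e hni, fun _ => rfl⟩
          · obtain ⟨S, T, hn⟩ := exists_primaryDecomposition (M n) ((hq n).symm ▸ hp) (hL n)
            exact ⟨S, T, hn, fun e => absurd e hni, fun e => absurd e hnj⟩
      choose S T hST hTi' hTj' using hex
      refine ⟨h, S, T, hST, fun r => ?_⟩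
      have ei : T i = Ti := hTi' i rfl
      have ej : T j = Tj := hTj' j rfl
      rw [ei, ej, hTi]
  have hMS : ∀ n r, M n * S n r = S n r * T n r := fun n => (hST n).mul_eq
  have hmT : ∀ n r, minpoly 𝕜 (T n r) = p r ^ μ r := fun n => (hST n).2
  have hcore : ∀ n m, modeProd n (Matrix.blockDiagonal' (T n)).transpose (coreTensor A S) =
      modeProd m (Matrix.blockDiagonal' (T m)).transpose (coreTensor A S) := fun n m =>
    (modeProd_coreTensor _hB hMS n).trans (modeProd_coreTensor _hB hMS m).symm
  have hD : IsBlockDiagonal (coreTensor A S) :=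
    isBlockDiagonal_of_modeProd_eq hcore (P := fun r => p r ^ μ r) (fun r s => hp.isCoprime)
      fun n r => by rw [← hmT n r, minpoly.aeval]
  have hint : ∀ r n m, modeProd n (T n r).transpose (diagBlock (coreTensor A S) r) =
      modeProd m (T m r).transpose (diagBlock (coreTensor A S) r) := fun r n m => by
    rw [← diagBlock_modeProd, ← diagBlock_modeProd, hcore n m]
  refine ⟨hD, hint, fun X hSX => ?_⟩
  have hone : ∀ n r, (S n r).transpose * X n r = 1 := fun n =>
    (hSX n).transpose_mul_self_eq_one
  -- The mode carrying `T` is free, so below it is moved to wherever `T` is known to be invertible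
  -- or scalar.
  have hterm : ∀ n m r, termB n A S T X r = termB m A S T X r := fun n m r => by
    rw [termB, termB, hint r n m]
  have hAr := isMLRank_termA _hA hSX hD
  have hBr : ∀ r (n : FirstMode N Nh),
      (unfolding (termB (modeOne hNh hle) A S T X r) n.1).rank ≤ L n r := fun r n =>
    rank_unfolding_mlTerm_le (S := fun n => S n r) _ n (hone n r)
  have hBsum : B = ∑ r, termB (modeOne hNh hle) A S T X r := by
    apply unfolding_injective (modeOne hNh hle).1
    simp only
    rw [_hB, unfolding_sum]
    conv_lhs => rw [sum_termA A hSX hD, unfolding_sum, Matrix.sum_mul]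
    exact Finset.sum_congr rfl fun r _ => unfolding_mlTerm_mul _ _ _
      (transpose_mul_eq_mul_transpose (hSX _) (hMS _) r)
  have hscal : ∀ r n (c : 𝕜), T n r = c • (1 : Matrix (Fin (L n r)) (Fin (L n r)) 𝕜) →
      termB (modeOne hNh hle) A S T X r = c • termA A S X r := fun r n c hc => by
    rw [hterm _ n, termB, hc, Matrix.transpose_smul, Matrix.transpose_one, modeProd_smul_one,
      mlTerm_smul, termA]
  refine ⟨⟨sum_termA A hSX hD, hAr⟩, ⟨hBsum, hBr, fun r hr n => ?_⟩, hscal, fun c hc => ⟨?_, ?_⟩⟩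
  · obtain ⟨Q, hQ⟩ := isUnit_of_minpoly_eq_pow (hp.2.1 r) (hp.1 r) hr (hmT n r)
    refine le_antisymm (hBr r n) ?_
    rw [← hAr r n, hterm _ n]
    exact rank_unfolding_termA_le_termB (hone n r) hQ
  · rw [hBsum]
    refine Finset.sum_congr rfl fun r _ => ?_
    obtain ⟨n, hn⟩ := hc r
    exact hscal r n (c r) hn
  · intro r
    obtain ⟨n, hn⟩ := hc r
    exact eq_zero_iff_of_minpoly_smul_one (hp.2.1 r) (hp.1 r) (hp.2.2.2.1 r) (hn ▸ hmT n r)
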